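/- **Theorem 2.2 (comparison principle).** Let $2\le k\le n$, let $\Omega\subset\mathbb R^n$ be a bounded domain with smooth boundary, and put $\mathcal D=\overline\Omega\times\mathbb R\times\mathbb R^n$. Let $A=[A_{ij}(x,z,p)]$ be a symmetric and $B=[B_{ij}(x,z,p)]$ a skew-symmetric real $n\times n$ matrix-valued function on $\mathcal D$ and $f=f(x,z,p)$ a real function on $\mathcal D$, with $A,f\in C^1(\mathcal D)$ and $B\in BC^1(\mathcal D)$ (that is, $B$ is $C^1$ and bounded together with its first derivatives). For a real $n\times n$ matrix $R$ with complex eigenvalues $\lambda_1,\dots,\lambda_n$ (counted with multiplicity) let $S_k(R)=\sum_{1\le i_1<\dots<i_k\le n}\lambda_{i_1}\cdots\lambda_{i_k}$. For $w\in C^2(\overline\Omega)$ and $x\in\overline\Omega$ put $$\omega(x,w)=D^2w(x)-A(x,w(x),Dw(x)),\qquad R(x,w)=\omega(x,w)-B(x,w(x),Dw(x)),$$ $$\lambda_w=\inf_{x\in\overline\Omega}\lambda_{\min}(\omega(x,w)),\qquad G_k[w](x)=\log S_k(R(x,w))-\log f(x,w(x),Dw(x)),$$ where $\lambda_{\min}$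 denotes the least eigenvalue of a symmetric matrix. For a bounded matrix-valued function $M$ on $\mathcal D$ let $\mu(M)=\sup_{\mathcal D}\|M\|$, where $\|\cdot\|$ is the operator norm with respect to the Euclidean norm. Let $0<\delta<1$, $\beta_1>0$ and $u,v\in C^2(\overline\Omega)$, and assume: 1. $G_k[u](x)\le G_k[v](x)$ for all $x\in\Omega$; 2. $\lambda_u>0$ and $\lambda_v>0$; 3. $D_zA(x,z,p)\ge 0$ (positive semidefinite) for all $(x,z,p)\in\mathcal D$; 4. $\mu(B)\le\delta\min(\lambda_u,\lambda_v)$; 5. $\mu(D_zB)\le\beta_1\min(\lambda_u,\lambda_v)$; 6. $f>0$ on $\mathcal D$; 7. $\displaystyle\inf_{\mathcal D}\frac{D_zf}{f}\ge\frac{k\delta}{1+\delta^2}\,\beta_1$. Then: (a) if $u\ge v$ on $\partial\Omega$, then $u\ge v$ in $\Omega$; (b) if $u=v$ on $\partial\Omega$, then $\dfrac{\partial u}{\partial\nu}\ge\dfrac{\partial v}{\partial\nu}$ on $\partial\Omega$, where $\nu$ is the unit inward normal to $\partial\Omega$. -/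

import Mathlib

open scoped ContDiff

noncomputable section

namespace NonsymHessian

/-- `ℝⁿ` with the Euclidean norm. -/
abbrev E (n : ℕ) : Type := EuclideanSpace ℝ (Fin n)

/-- The `i`-th vector of the standard basis of `ℝⁿ`. -/
def basisVec {n : ℕ} (i : Fin n) : E n := EuclideanSpace.single i 1

/-! ### Domains with smooth boundary -/

/-- On the open neighbourhood `U` of `x₀`, the set `Ω` is `{ρ > 0}`, where `ρ` is smooth on `U`,
vanishes at `x₀` and has nonzero gradient there. -/
structure IsLocalDefiningFunction {n : ℕ} (Ω : Set (E n)) (x₀ : E n) (U : Set (E n))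
    (ρ : E n → ℝ) : Prop where
  isOpen : IsOpen U
  mem : x₀ ∈ U
  smooth : ContDiffOn ℝ ∞ ρ U
  mem_iff : ∀ y ∈ U, (y ∈ Ω ↔ 0 < ρ y)
  zero : ρ x₀ = 0
  gradient_ne_zero : gradient ρ x₀ ≠ 0

/-- `Ω` is a bounded domain (nonempty, open, connected) with smooth boundary. -/
structure IsBoundedSmoothDomain {n : ℕ} (Ω : Set (E n)) : Prop where
  isOpen : IsOpen Ω
  isConnected : IsConnected Ω
  isBounded : Bornology.IsBounded Ω
  smooth_boundary : ∀ x₀ ∈ frontier Ω, ∃ U ρ, IsLocalDefiningFunction Ω x₀ U ρ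

/-- `ν` is the unit inward normal to `∂Ω` at `x₀`: the normalized gradient of a function which
locally defines `Ω` as its positivity set. -/
def IsInwardUnitNormal {n : ℕ} (Ω : Set (E n)) (x₀ ν : E n) : Prop :=
  ∃ U ρ, IsLocalDefiningFunction Ω x₀ U ρ ∧ ν = ‖gradient ρ x₀‖⁻¹ • gradient ρ x₀

/-! ### Matrices -/

/-- The operator norm of a matrix (with respect to the Euclidean norm). -/
def opNorm {n : ℕ} (M : Matrix (Fin n) (Fin n) ℝ) : ℝ :=
  ‖Matrix.toEuclideanCLM (n := Fin n) (𝕜 := ℝ) M‖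

/-- The least (real) eigenvalue of `M`, used for symmetric matrices. -/
def lambdaMin {n : ℕ} (M : Matrix (Fin n) (Fin n) ℝ) : ℝ :=
  sInf (spectrum ℝ M)

/-- `S_k(R) = σ_k(λ(R))`, the `k`-th elementary symmetric polynomial of the complex eigenvalues of
the real matrix `R`, counted with algebraic multiplicity. This number is real. -/
def Sk {n : ℕ} (k : ℕ) (R : Matrix (Fin n) (Fin n) ℝ) : ℝ :=
  ((R.map Complex.ofReal).charpoly.roots.esymm k).re

/-! ### Functions on `Ω̄` -/

/-- The class `C²(Ω̄)`. -/
def IsC2 {n : ℕ} (Ω : Set (E n)) (u : E n → ℝ) : Prop :=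
  ContDiffOn ℝ 2 u (closure Ω)

/-- The gradient `Du(x)`, up to the boundary. -/
def grad {n : ℕ} (Ω : Set (E n)) (u : E n → ℝ) (x : E n) : E n :=
  gradientWithin u (closure Ω) x

/-- The Hessian matrix `D²u(x)`, up to the boundary. -/
def hess {n : ℕ} (Ω : Set (E n)) (u : E n → ℝ) (x : E n) : Matrix (Fin n) (Fin n) ℝ :=
  Matrix.of fun i j =>
    fderivWithin ℝ (fderivWithin ℝ u (closure Ω)) (closure Ω) x (basisVec i) (basisVec j)

/-- The directional derivative `∂u/∂ν (x) = Du(x) · ν`. -/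
def normalDeriv {n : ℕ} (Ω : Set (E n)) (u : E n → ℝ) (x ν : E n) : ℝ :=
  inner ℝ (grad Ω u x) ν

/-! ### Coefficients, functions of `(x, z, p) ∈ 𝒟 = Ω̄ × ℝ × ℝⁿ` -/

/-- The set `𝒟 = Ω̄ × ℝ × ℝⁿ`. -/
def dom {n : ℕ} (Ω : Set (E n)) : Set (E n × ℝ × E n) :=
  {q | q.1 ∈ closure Ω}

/-- The class `C¹(𝒟)` of scalar functions. -/
def IsC1 {n : ℕ} (Ω : Set (E n)) (g : E n × ℝ × E n → ℝ) : Prop :=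
  ContDiffOn ℝ 1 g (dom Ω)

/-- The class `BC¹(𝒟)` of scalar functions: those of class `C¹(𝒟)` that are bounded together with
their first derivatives. -/
def IsBC1 {n : ℕ} (Ω : Set (E n)) (g : E n × ℝ × E n → ℝ) : Prop :=
  IsC1 Ω g ∧ ∃ C : ℝ, ∀ q ∈ dom Ω, |g q| ≤ C ∧ ‖fderivWithin ℝ g (dom Ω) q‖ ≤ C

/-- Partial derivative `D_z` of a scalar function. -/
def Dz {n : ℕ} (g : E n × ℝ × E n → ℝ) (q : E n × ℝ × E n) : ℝ :=
  deriv (fun t => g (q.1, t, q.2.2)) q.2.1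

/-- Entrywise partial derivative `D_z` of a matrix-valued function. -/
def DzMat {n : ℕ} (M : E n × ℝ × E n → Matrix (Fin n) (Fin n) ℝ) (q : E n × ℝ × E n) :
    Matrix (Fin n) (Fin n) ℝ :=
  Matrix.of fun i j => Dz (fun r => M r i j) q

/-- `μ(M) = sup_𝒟 ‖M‖`, for bounded `M`. -/
def mu {n : ℕ} (Ω : Set (E n)) (M : E n × ℝ × E n → Matrix (Fin n) (Fin n) ℝ) : ℝ :=
  sSup ((fun q => opNorm (M q)) '' dom Ω)

/-! ### The equation -/

/-- `ω(x,u) = D²u(x) - A(x,u(x),Du(x))`. -/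
def omega {n : ℕ} (Ω : Set (E n)) (A : E n × ℝ × E n → Matrix (Fin n) (Fin n) ℝ)
    (u : E n → ℝ) (x : E n) : Matrix (Fin n) (Fin n) ℝ :=
  hess Ω u x - A (x, u x, grad Ω u x)

/-- `λ_u = inf_{x ∈ Ω̄} λ_min(ω(x,u))`. -/
def lambdaInf {n : ℕ} (Ω : Set (E n)) (A : E n × ℝ × E n → Matrix (Fin n) (Fin n) ℝ)
    (u : E n → ℝ) : ℝ :=
  sInf ((fun x => lambdaMin (omega Ω A u x)) '' closure Ω)

/-- `R(x,u) = ω(x,u) - B(x,u(x),Du(x))`. -/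
def Rmat {n : ℕ} (Ω : Set (E n)) (A B : E n × ℝ × E n → Matrix (Fin n) (Fin n) ℝ)
    (u : E n → ℝ) (x : E n) : Matrix (Fin n) (Fin n) ℝ :=
  omega Ω A u x - B (x, u x, grad Ω u x)

/-- `G_k[u](x) = log S_k(R(x,u)) - log f(x,u(x),Du(x))`. -/
def Gk {n : ℕ} (k : ℕ) (Ω : Set (E n)) (A B : E n × ℝ × E n → Matrix (Fin n) (Fin n) ℝ)
    (f : E n × ℝ × E n → ℝ) (u : E n → ℝ) (x : E n) : ℝ :=
  Real.log (Sk k (Rmat Ω A B u x)) - Real.log (f (x, u x, grad Ω u x))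

end NonsymHessian

end

/-! Suppose `u < v` somewhere while `u ≥ v` on the boundary. For a suitable `ε > 0`, the function `u
- v - ε exp (γ (x₁ + ⋯ + xₙ))` has an interior minimum with `u < v`. There the gradients differ by a
multiple of the vector of ones, of size of order `a = ε γ exp (⋯)`, and the Hessian of `u - v`
dominates `a γ J`, where `J` is the matrix of ones. So `R(x,u) - R(x,v) = P + a γ J - Γ + N`. Here
`P ≥ 0` also absorbs the monotonicity of `A` in `z`, `Γ` is the skew increment of `B` in `z`, with
norm at most `β₁ c (v - u)` where `c = min (λ_u, λ_v)`, and `N = O(a)` comes from the change of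
gradient in `A` and `B`.

`S_k` is the sum of the principal `k × k` minors, so along the segment joining the two matrices the
derivative of `log S_k` is a weighted mean of traces `tr (R_I⁻¹ H_I)`. In each trace `P` contributes
nonnegatively, `J` at least a positive constant, and `N` at least `-O(a)`. The skew term costs at
most `k δ / (1 + δ²) β₁ (v - u)`. This sharp bound (`trace_inv_mul_skew_le`, resting on
`skew_bilin_le`) is the heart of the proof: the cost is exactly what the growth of `log f` in `z`
pays for.

What remains is `a` times (a positive multiple of `γ` minus a constant). A large `γ` makes it
positive, so `G_k[u] > G_k[v]` at the minimum, a contradiction. All errors are linear in `a`, so `ε`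
need not be small. Part (b) follows from (a) by difference quotients along the inward normal. -/

namespace NonsymHessian

open Matrix

/-! ### Inverses and determinants of coercive, not necessarily symmetric, matrices. -/

section LinearAlgebra

variable {ι κ : Type*} [Fintype ι] [Fintype κ]

/-- `2 p·Mq ≤ c (|p|² + |q|²)` for all vectors; this says that the operator norm of `M` is at
most `c`. -/
def BilinBound (M : Matrix ι ι ℝ) (c : ℝ) : Prop :=
  ∀ p q : ι → ℝ, 2 * (p ⬝ᵥ M *ᵥ q) ≤ c * (p ⬝ᵥ p + q ⬝ᵥ q)

/-- `x·Mx ≥ c |x|²` for all vectors `x`. -/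
def Coercive (M : Matrix ι ι ℝ) (c : ℝ) : Prop :=
  ∀ x : ι → ℝ, c * (x ⬝ᵥ x) ≤ x ⬝ᵥ M *ᵥ x

theorem dotProduct_extend {e : κ → ι} (he : Function.Injective e) (x : κ → ℝ) (g : ι → ℝ) :
    Function.extend e x 0 ⬝ᵥ g = x ⬝ᵥ (g ∘ e) := by
  refine (Fintype.sum_of_injective e he _ _ ?_ ?_).symm
  · intro i hi
    rw [Function.extend_apply' _ _ _ (by simpa using hi)]
    simp
  · intro i
    simp [he.extend_apply]

/-- Padding vectors by zeros preserves lengths and turns the form of a principal submatrix into that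
of the full matrix. Hence coercivity and norm bounds pass to principal submatrices with the same
constants. -/
theorem dotProduct_submatrix_mulVec {e : κ → ι} (he : Function.Injective e)
    (M : Matrix ι ι ℝ) (x y : κ → ℝ) :
    x ⬝ᵥ M.submatrix e e *ᵥ y =
      Function.extend e x 0 ⬝ᵥ M *ᵥ Function.extend e y 0 := by
  rw [dotProduct_extend he]
  congr 1
  ext i
  simp only [mulVec, Function.comp_apply]
  rw [dotProduct_comm _ (Function.extend e y 0), dotProduct_extend he, dotProduct_comm]
  rfl

theorem dotProduct_extend_self {e : κ → ι} (he : Function.Injective e) (x : κ → ℝ) :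
    Function.extend e x 0 ⬝ᵥ Function.extend e x 0 = x ⬝ᵥ x := by
  rw [dotProduct_extend he]
  congr 1
  ext i
  simp [he.extend_apply]

theorem BilinBound.submatrix {M : Matrix ι ι ℝ} {c : ℝ} (h : BilinBound M c) {e : κ → ι}
    (he : Function.Injective e) : BilinBound (M.submatrix e e) c := fun p q => by
  rw [dotProduct_submatrix_mulVec he, ← dotProduct_extend_self he p,
    ← dotProduct_extend_self he q]
  exact h _ _

theorem Coercive.submatrix {M : Matrix ι ι ℝ} {c : ℝ} (h : Coercive M c) {e : κ → ι}
    (he : Function.Injective e) : Coercive (M.submatrix e e) c := fun x => by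
  rw [dotProduct_submatrix_mulVec he, ← dotProduct_extend_self he x]
  exact h _

theorem Coercive.convex_comb {M N : Matrix ι ι ℝ} {c t : ℝ} (hM : Coercive M c)
    (hN : Coercive N c) (h0 : 0 ≤ t) (h1 : t ≤ 1) : Coercive (M + t • (N - M)) c := fun x => by
  have h2 := mul_le_mul_of_nonneg_left (hM x) (sub_nonneg.2 h1)
  have h3 := mul_le_mul_of_nonneg_left (hN x) h0
  simp only [add_mulVec, smul_mulVec, sub_mulVec, dotProduct_add, dotProduct_smul,
    dotProduct_sub, smul_eq_mul]
  linarith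

theorem BilinBound.convex_comb {M N : Matrix ι ι ℝ} {c t : ℝ} (hM : BilinBound M c)
    (hN : BilinBound N c) (h0 : 0 ≤ t) (h1 : t ≤ 1) : BilinBound (M + t • (N - M)) c :=
  fun p q => by
  have h2 := mul_le_mul_of_nonneg_left (hM p q) (sub_nonneg.2 h1)
  have h3 := mul_le_mul_of_nonneg_left (hN p q) h0
  simp only [add_mulVec, smul_mulVec, sub_mulVec, dotProduct_add, dotProduct_smul,
    dotProduct_sub, smul_eq_mul]
  linarith

theorem dotProduct_mulVec_of_skew {β : Matrix ι ι ℝ} (hβ : βᵀ = -β) (x y : ι → ℝ) :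
    x ⬝ᵥ β *ᵥ y = -(y ⬝ᵥ β *ᵥ x) := by
  rw [dotProduct_mulVec, ← mulVec_transpose, hβ, neg_mulVec, neg_dotProduct, dotProduct_comm]

theorem dotProduct_mulVec_self_of_skew {β : Matrix ι ι ℝ} (hβ : βᵀ = -β) (x : ι → ℝ) :
    x ⬝ᵥ β *ᵥ x = 0 := by
  have := dotProduct_mulVec_of_skew hβ x x
  linarith

theorem dotProduct_mulVec_of_symm {W : Matrix ι ι ℝ} (hW : Wᵀ = W) (x y : ι → ℝ) :
    x ⬝ᵥ W *ᵥ y = y ⬝ᵥ W *ᵥ x := by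
  rw [dotProduct_mulVec, ← mulVec_transpose, hW, dotProduct_comm]

theorem Coercive.sub_skew {W β : Matrix ι ι ℝ} {c : ℝ} (hW : Coercive W c) (hβ : βᵀ = -β) :
    Coercive (W - β) c := fun x => by
  rw [sub_mulVec, dotProduct_sub, dotProduct_mulVec_self_of_skew hβ, sub_zero]
  exact hW x

theorem dotProduct_self_nonneg' (x : ι → ℝ) : 0 ≤ x ⬝ᵥ x :=
  Finset.sum_nonneg fun i _ => mul_self_nonneg (x i)

theorem dotProduct_self_pos_of_ne_zero {x : ι → ℝ} (hx : x ≠ 0) : 0 < x ⬝ᵥ x :=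
  lt_of_le_of_ne (dotProduct_self_nonneg' x) fun h => hx (dotProduct_self_eq_zero.1 h.symm)

theorem dotProduct_sq_le (x y : ι → ℝ) : (x ⬝ᵥ y) ^ 2 ≤ (x ⬝ᵥ x) * (y ⬝ᵥ y) := by
  have := Finset.sum_mul_sq_le_sq_mul_sq Finset.univ x y
  simpa [dotProduct, pow_two] using this

variable [DecidableEq ι] [DecidableEq κ]

theorem Coercive.det_ne_zero {M : Matrix ι ι ℝ} {c : ℝ} (hc : 0 < c) (hM : Coercive M c) :
    M.det ≠ 0 := by
  intro h
  obtain ⟨v, hv, hMv⟩ := exists_mulVec_eq_zero_iff.2 h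
  have h1 := hM v
  rw [hMv, dotProduct_zero] at h1
  have := mul_pos hc (dotProduct_self_pos_of_ne_zero hv)
  linarith

theorem coercive_smul_one (c : ℝ) : Coercive (c • (1 : Matrix ι ι ℝ)) c := fun x => by
  simp [smul_mulVec]

/-- The segment from `c • 1` to `M` stays coercive, so the determinant never vanishes on it and
keeps its sign. -/
theorem Coercive.det_pos {M : Matrix ι ι ℝ} {c : ℝ} (hc : 0 < c) (hM : Coercive M c) :
    0 < M.det := by
  by_contra! hneg
  set g : ℝ → ℝ := fun t => (c • (1 : Matrix ι ι ℝ) + t • (M - c • 1)).det with hg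
  have hcont : ContinuousOn g (Set.Icc 0 1) := by
    apply Continuous.continuousOn
    exact Continuous.matrix_det (by fun_prop)
  have hg0 : 0 ≤ g 0 := by
    simp only [hg, zero_smul, add_zero, det_smul, det_one, mul_one]
    positivity
  have hg1 : g 1 ≤ 0 := by simpa [hg] using hneg
  obtain ⟨t, ht, h0⟩ := intermediate_value_Icc' zero_le_one hcont ⟨hg1, hg0⟩
  exact ((coercive_smul_one c).convex_comb hM ht.1 ht.2).det_ne_zero hc h0

theorem Coercive.mul_inv_cancel {M : Matrix ι ι ℝ} {c : ℝ} (hc : 0 < c) (hM : Coercive M c) :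
    M * M⁻¹ = 1 :=
  mul_nonsing_inv _ (isUnit_iff_ne_zero.2 (hM.det_ne_zero hc))

theorem Coercive.mulVec_inv_mulVec {M : Matrix ι ι ℝ} {c : ℝ} (hc : 0 < c) (hM : Coercive M c)
    (x : ι → ℝ) : M *ᵥ (M⁻¹ *ᵥ x) = x := by
  rw [mulVec_mulVec, hM.mul_inv_cancel hc, one_mulVec]

theorem Coercive.inv_quadratic {M : Matrix ι ι ℝ} {c : ℝ} (hc : 0 < c) (hM : Coercive M c)
    (x : ι → ℝ) : c * ((M⁻¹ *ᵥ x) ⬝ᵥ (M⁻¹ *ᵥ x)) ≤ x ⬝ᵥ M⁻¹ *ᵥ x := by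
  have := hM (M⁻¹ *ᵥ x)
  rwa [hM.mulVec_inv_mulVec hc, dotProduct_comm _ x] at this

/-- The column `y = M⁻¹ eⱼ` satisfies `c |y|² ≤ yⱼ ≤ |y|`, hence `|y| ≤ c⁻¹`. -/
theorem Coercive.abs_inv_apply_le {M : Matrix ι ι ℝ} {c : ℝ} (hc : 0 < c) (hM : Coercive M c)
    (i j : ι) : |M⁻¹ i j| ≤ c⁻¹ := by
  have h := hM.inv_quadratic hc (Pi.single j 1)
  set y := M⁻¹ *ᵥ Pi.single j 1 with hy
  have hyi : ∀ i, y i = M⁻¹ i j := fun i => by simp [hy]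
  rw [single_dotProduct, one_mul] at h
  have hle : ∀ i, y i ^ 2 ≤ y ⬝ᵥ y := fun i => by
    rw [pow_two]
    exact Finset.single_le_sum (f := fun i => y i * y i) (fun i _ => mul_self_nonneg _)
      (Finset.mem_univ i)
  have hj : c * y j ≤ 1 := by
    by_contra! h1
    have := mul_le_mul_of_nonneg_left (hle j) hc.le
    have h2 : 0 < y j := by
      by_contra! h3
      nlinarith
    nlinarith
  have h4 : c * (c * y i ^ 2) ≤ 1 := by
    calc c * (c * y i ^ 2) ≤ c * (c * (y ⬝ᵥ y)) := by gcongr; exact hle i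
      _ ≤ c * y j := by gcongr
      _ ≤ 1 := hj
  rw [← hyi]
  refine abs_le_of_sq_le_sq ?_ (by positivity)
  rw [inv_pow, ← one_div, le_div_iff₀ (by positivity)]
  linarith

theorem trace_mul_eq_sum (N M : Matrix ι ι ℝ) :
    (N * M).trace = ∑ i, Pi.single i 1 ⬝ᵥ N *ᵥ (M *ᵥ Pi.single i 1) := by
  simp only [single_dotProduct, mulVec_single_one, one_mul]
  rfl

-- Writing `P = CᵀC`, the trace becomes the sum of the values of the form of `M⁻¹` at the rows of
-- `C`; symmetry of `M` plays no role.
open scoped MatrixOrder in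
theorem Coercive.trace_inv_mul_posSemidef_nonneg {M P : Matrix ι ι ℝ} {c : ℝ} (hc : 0 < c)
    (hM : Coercive M c) (hP : P.PosSemidef) : 0 ≤ (M⁻¹ * P).trace := by
  obtain ⟨C, rfl⟩ := CStarAlgebra.nonneg_iff_eq_star_mul_self.mp hP.nonneg
  rw [star_eq_conjTranspose, conjTranspose_eq_transpose_of_trivial, ← Matrix.mul_assoc,
    trace_mul_comm, ← Matrix.mul_assoc]
  refine Finset.sum_nonneg fun i _ => ?_
  have h := hM.inv_quadratic hc (C i)
  have h0 := mul_nonneg hc.le (dotProduct_self_nonneg' (M⁻¹ *ᵥ C i))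
  have : (C * M⁻¹ * Cᵀ).diag i = C i ⬝ᵥ M⁻¹ *ᵥ C i := by
    rw [dotProduct_mulVec]
    rfl
  rw [this]
  linarith

/-- The trace is `1 · y` with `y = M⁻¹ 1`, which is at least `c |y|²`. A single row of `M y = 1` and
Cauchy–Schwarz keep `|y|` away from zero. -/
theorem Coercive.le_trace_inv_mul_ones {M : Matrix ι ι ℝ} {c m : ℝ} (hc : 0 < c)
    (hM : Coercive M c) (hm : ∀ i j, |M i j| ≤ m) (hm0 : 0 < m) (hι : 0 < Fintype.card ι) :
    c / (Fintype.card ι * m ^ 2) ≤ (M⁻¹ * Matrix.of fun _ _ => (1 : ℝ)).trace := by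
  have h := hM.inv_quadratic hc 1
  set y := M⁻¹ *ᵥ (1 : ι → ℝ) with hy
  have htr : (M⁻¹ * Matrix.of fun _ _ => (1 : ℝ)).trace = 1 ⬝ᵥ y := by
    simp [trace, mul_apply, hy, mulVec, dotProduct]
  rw [htr]
  refine le_trans ?_ h
  have hMy : M *ᵥ y = 1 := hM.mulVec_inv_mulVec hc 1
  have hrow : ∀ i, (1 : ℝ) ≤ Fintype.card ι * m ^ 2 * (y ⬝ᵥ y) := fun i => by
    have h1 : (M *ᵥ y) i = 1 := by rw [hMy]; rfl
    have h2 := dotProduct_sq_le (M i) y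
    have h3 : M i ⬝ᵥ y = 1 := h1
    rw [h3, one_pow] at h2
    refine h2.trans (mul_le_mul_of_nonneg_right ?_ (dotProduct_self_nonneg' y))
    calc M i ⬝ᵥ M i ≤ ∑ _j : ι, m ^ 2 := Finset.sum_le_sum fun j _ => by
          rw [← pow_two, ← sq_abs]
          exact pow_le_pow_left₀ (abs_nonneg _) (hm i j) 2
      _ = _ := by simp
  obtain ⟨i⟩ := Fintype.card_pos_iff.1 hι
  have h1 := hrow i
  have hk : (0 : ℝ) < Fintype.card ι := by exact_mod_cast hι
  rw [div_le_iff₀ (by positivity)]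
  nlinarith

theorem Coercive.neg_le_trace_inv_mul {M N : Matrix ι ι ℝ} {c e : ℝ} (hc : 0 < c)
    (hM : Coercive M c) (hN : ∀ i j, |N i j| ≤ e) :
    -((Fintype.card ι : ℝ) ^ 2 * e / c) ≤ (M⁻¹ * N).trace := by
  have h : |(M⁻¹ * N).trace| ≤ ∑ _i : ι, ∑ _j : ι, c⁻¹ * e := by
    refine (Finset.abs_sum_le_sum_abs _ _).trans (Finset.sum_le_sum fun i _ => ?_)
    refine (Finset.abs_sum_le_sum_abs _ _).trans (Finset.sum_le_sum fun j _ => ?_)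
    rw [abs_mul]
    exact mul_le_mul (hM.abs_inv_apply_le hc i j) (hN j i) (abs_nonneg _) (by positivity)
  have h2 : ∑ _i : ι, ∑ _j : ι, c⁻¹ * e = (Fintype.card ι : ℝ) ^ 2 * e / c := by
    simp only [Finset.sum_const, Finset.card_univ, nsmul_eq_mul]
    field_simp
  rw [h2] at h
  exact (abs_le.1 h).1

-- This is Cauchy–Schwarz for `p + iq` and `r + is`. The real inequality is applied after
-- multiplying the first vector by `a + ib`, which makes its real pairing with the second equal to
-- `a² + b²`.
omit [DecidableEq ι] in
theorem complex_cauchy_schwarz (p q r s : ι → ℝ) :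
    (p ⬝ᵥ r + q ⬝ᵥ s) ^ 2 + (p ⬝ᵥ s - q ⬝ᵥ r) ^ 2 ≤
      (p ⬝ᵥ p + q ⬝ᵥ q) * (r ⬝ᵥ r + s ⬝ᵥ s) := by
  set a := p ⬝ᵥ r + q ⬝ᵥ s with ha
  set b := p ⬝ᵥ s - q ⬝ᵥ r with hb
  have h := Finset.sum_mul_sq_le_sq_mul_sq (Finset.univ : Finset (ι ⊕ ι))
    (Sum.elim (a • p - b • q) (a • q + b • p)) (Sum.elim r s)
  simp only [Fintype.sum_sum_type, Sum.elim_inl, Sum.elim_inr, pow_two] at h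
  have h1 : (∑ i, (a • p - b • q) i * r i) = a * (p ⬝ᵥ r) - b * (q ⬝ᵥ r) := by
    change (a • p - b • q) ⬝ᵥ r = _
    simp
  have h2 : (∑ i, (a • q + b • p) i * s i) = a * (q ⬝ᵥ s) + b * (p ⬝ᵥ s) := by
    change (a • q + b • p) ⬝ᵥ s = _
    simp
  have h3 : (∑ i, (a • p - b • q) i * (a • p - b • q) i) =
      a * a * (p ⬝ᵥ p) - 2 * a * b * (p ⬝ᵥ q) + b * b * (q ⬝ᵥ q) := by
    change (a • p - b • q) ⬝ᵥ (a • p - b • q) = _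
    simp [dotProduct_comm q p]
    ring
  have h4 : (∑ i, (a • q + b • p) i * (a • q + b • p) i) =
      a * a * (q ⬝ᵥ q) + 2 * a * b * (p ⬝ᵥ q) + b * b * (p ⬝ᵥ p) := by
    change (a • q + b • p) ⬝ᵥ (a • q + b • p) = _
    simp [dotProduct_comm q p]
    ring
  have h5 : (∑ i, r i * r i) = r ⬝ᵥ r := rfl
  have h6 : (∑ i, s i * s i) = s ⬝ᵥ s := rfl
  rw [h1, h2, h3, h4, h5, h6] at h
  have h7 : (a ^ 2 + b ^ 2) * (a ^ 2 + b ^ 2) ≤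
      (a ^ 2 + b ^ 2) * ((p ⬝ᵥ p + q ⬝ᵥ q) * (r ⬝ᵥ r + s ⬝ᵥ s)) := by
    have : a * (p ⬝ᵥ r) - b * (q ⬝ᵥ r) + (a * (q ⬝ᵥ s) + b * (p ⬝ᵥ s)) = a ^ 2 + b ^ 2 := by
      rw [ha, hb]; ring
    rw [this] at h
    linarith
  rcases (by positivity : 0 ≤ a ^ 2 + b ^ 2).eq_or_lt with h8 | h8
  · rw [← h8]
    have := dotProduct_self_nonneg' p
    have := dotProduct_self_nonneg' q
    have := dotProduct_self_nonneg' r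
    have := dotProduct_self_nonneg' s
    positivity
  · exact le_of_mul_le_mul_left h7 h8

omit [DecidableEq ι] in
/-- The bound behind the estimate of the skew part of the inverse of `W - β`. -/
theorem skew_bilin_le {W β : Matrix ι ι ℝ} {c δ : ℝ} (hc : 0 < c) (hδ : 0 < δ) (hδ1 : δ < 1)
    (hW : Wᵀ = W) (hcW : Coercive W c) (hβ : βᵀ = -β) (hbβ : BilinBound β (δ * c))
    (p q : ι → ℝ) :
    2 * (p ⬝ᵥ β *ᵥ q) ≤ δ / ((1 + δ ^ 2) * c) *
      (((W - β) *ᵥ p) ⬝ᵥ ((W - β) *ᵥ p) + ((W - β) *ᵥ q) ⬝ᵥ ((W - β) *ᵥ q)) := by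
  -- With `ζ = p + iq`, the Hermitian pairing of `ζ` with `(W - β) ζ` has real part `a`, coming from
  -- `W`, and imaginary part `-b = -2 p·βq`.
  have hcs := complex_cauchy_schwarz p q ((W - β) *ᵥ p) ((W - β) *ᵥ q)
  set T := ((W - β) *ᵥ p) ⬝ᵥ ((W - β) *ᵥ p) + ((W - β) *ᵥ q) ⬝ᵥ ((W - β) *ᵥ q) with hT
  have hb : p ⬝ᵥ (W - β) *ᵥ q - q ⬝ᵥ (W - β) *ᵥ p = -(2 * (p ⬝ᵥ β *ᵥ q)) := by
    rw [sub_mulVec, sub_mulVec, dotProduct_sub, dotProduct_sub, dotProduct_mulVec_of_symm hW q p,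
      dotProduct_mulVec_of_skew hβ q p]
    ring
  have ha : c * (p ⬝ᵥ p + q ⬝ᵥ q) ≤ p ⬝ᵥ (W - β) *ᵥ p + q ⬝ᵥ (W - β) *ᵥ q := by
    have h1 := hcW.sub_skew hβ p
    have h2 := hcW.sub_skew hβ q
    linarith
  have hbb := hbβ p q
  set a := p ⬝ᵥ (W - β) *ᵥ p + q ⬝ᵥ (W - β) *ᵥ q with ha'
  set N := p ⬝ᵥ p + q ⬝ᵥ q with hN'
  rw [hb] at hcs
  set b := 2 * (p ⬝ᵥ β *ᵥ q) with hb'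
  have hN0 : 0 ≤ N := add_nonneg (dotProduct_self_nonneg' p) (dotProduct_self_nonneg' q)
  have hT0 : 0 ≤ T := add_nonneg (dotProduct_self_nonneg' _) (dotProduct_self_nonneg' _)
  rw [div_mul_eq_mul_div, le_div_iff₀ (by positivity)]
  rcases le_or_gt b 0 with hb0 | hb0
  · have h1 : b * ((1 + δ ^ 2) * c) ≤ 0 := mul_nonpos_of_nonpos_of_nonneg hb0 (by positivity)
    have h2 : 0 ≤ δ * T := by positivity
    linarith
  · have hNpos : 0 < N := by
      by_contra! h
      have : δ * c * N ≤ 0 := mul_nonpos_of_nonneg_of_nonpos (by positivity) h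
      linarith
    have hba : b ≤ δ * a := hbb.trans (by nlinarith)
    have ha0 : 0 ≤ a := le_trans (by positivity) ha
    have hda : δ * b ≤ a := calc
      δ * b ≤ 1 * (1 * a) := by gcongr; exact hba.trans (by gcongr)
      _ = a := by ring
    -- Expanded, this reads `(1 + δ²) a b ≤ δ (a² + b²)`: the function `t / (1 + t²)` increases on
    -- `[0, 1]` and `b / a ≤ δ < 1`. This is the source of the constant `δ / (1 + δ²)`.
    have key : 0 ≤ (δ * a - b) * (a - δ * b) := mul_nonneg (by linarith) (by linarith)
    refine le_of_mul_le_mul_left ?_ hNpos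
    calc N * (b * ((1 + δ ^ 2) * c)) = (1 + δ ^ 2) * b * (c * N) := by ring
      _ ≤ (1 + δ ^ 2) * b * a := by gcongr
      _ ≤ δ * (a ^ 2 + (-b) ^ 2) := by nlinarith
      _ ≤ δ * (N * T) := by gcongr
      _ = N * (δ * T) := by ring

omit [DecidableEq ι] in
theorem BilinBound.dotProduct_mulVec_self_le {M : Matrix ι ι ℝ} {c : ℝ} (hc : 0 < c)
    (hM : BilinBound M c) (x : ι → ℝ) :
    (M *ᵥ x) ⬝ᵥ (M *ᵥ x) ≤ c ^ 2 * (x ⬝ᵥ x) := by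
  have h := hM (c⁻¹ • (M *ᵥ x)) x
  simp only [smul_dotProduct, dotProduct_smul, smul_eq_mul] at h
  have h2 := mul_le_mul_of_nonneg_left h hc.le
  field_simp at h2
  nlinarith

/-- Against a skew matrix only the skew part of the inverse `S` counts, and that part is `Sᵀ β S`,
whose bilinear form is controlled by `skew_bilin_le`. -/
theorem trace_inv_mul_skew_le {W β Γ : Matrix ι ι ℝ} {c δ g : ℝ} (hc : 0 < c) (hδ : 0 < δ)
    (hδ1 : δ < 1) (hW : Wᵀ = W) (hcW : Coercive W c) (hβ : βᵀ = -β)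
    (hbβ : BilinBound β (δ * c)) (hΓ : Γᵀ = -Γ) (hg : 0 < g) (hbΓ : BilinBound Γ g) :
    ((W - β)⁻¹ * Γ).trace ≤ Fintype.card ι * (δ / ((1 + δ ^ 2) * c) * g) := by
  have hR := hcW.sub_skew hβ
  have hcancel := hR.mul_inv_cancel hc
  have hinv : ∀ x, (W - β) *ᵥ ((W - β)⁻¹ *ᵥ x) = x := hR.mulVec_inv_mulVec hc
  have hT : (W - β)ᵀ = (W - β) + (2 : ℝ) • β := by
    rw [transpose_sub, hW, hβ, two_smul]
    abel
  set S := (W - β)⁻¹ with hS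
  have hST : Sᵀ * (W - β)ᵀ = 1 := by rw [← transpose_mul, hcancel, transpose_one]
  have hK : S - Sᵀ = (2 : ℝ) • (Sᵀ * β * S) := by
    have h1 : Sᵀ * ((W - β) + (2 : ℝ) • β) * S = S := by rw [← hT, hST, Matrix.one_mul]
    rw [Matrix.mul_add, Matrix.add_mul, Matrix.mul_assoc, hcancel, Matrix.mul_one] at h1
    rw [sub_eq_iff_eq_add', ← Matrix.smul_mul, ← Matrix.mul_smul]
    exact h1.symm
  have htr : (Sᵀ * Γ).trace = -(S * Γ).trace := by
    rw [← trace_transpose, transpose_mul, transpose_transpose, hΓ, Matrix.neg_mul, trace_neg,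
      trace_mul_comm]
  have htr2 : (S * Γ).trace = (Sᵀ * β * S * Γ).trace := by
    have h1 : ((S - Sᵀ) * Γ).trace = 2 * (Sᵀ * β * S * Γ).trace := by
      rw [hK, Matrix.smul_mul, trace_smul, smul_eq_mul]
    rw [Matrix.sub_mul, trace_sub, htr] at h1
    linarith
  rw [htr2, trace_mul_eq_sum]
  calc _ ≤ ∑ _i : ι, δ / ((1 + δ ^ 2) * c) * g := Finset.sum_le_sum fun i _ => ?_
    _ = _ := by simp
  set e : ι → ℝ := Pi.single i 1 with he
  have hee : e ⬝ᵥ e = 1 := by simp [he]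
  -- Scaling `e` by `g` balances the pair: `g e` has length `g` and `Γ e` has length at most `g`, so
  -- the sum of squares loses nothing against the product.
  have h1 := skew_bilin_le hc hδ hδ1 hW hcW hβ hbβ (S *ᵥ (g • e)) (S *ᵥ (Γ *ᵥ e))
  rw [hinv, hinv] at h1
  have h2 := hbΓ.dotProduct_mulVec_self_le hg e
  rw [hee, mul_one] at h2
  have h3 : (S *ᵥ (g • e)) ⬝ᵥ β *ᵥ (S *ᵥ (Γ *ᵥ e)) =
      g * (e ⬝ᵥ (Sᵀ * β * S) *ᵥ (Γ *ᵥ e)) := by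
    rw [mulVec_smul, smul_dotProduct, smul_eq_mul, ← mulVec_mulVec, ← mulVec_mulVec,
      dotProduct_mulVec e, vecMul_transpose]
  rw [h3, smul_dotProduct, dotProduct_smul, hee] at h1
  set κ' := δ / ((1 + δ ^ 2) * c) with hκ
  have hκ0 : 0 ≤ κ' := by positivity
  refine le_of_mul_le_mul_left ?_ (mul_pos two_pos hg)
  have h4 := mul_le_mul_of_nonneg_left h2 hκ0
  simp only [smul_eq_mul] at h1
  nlinarith

/-- Jacobi's formula along a segment. -/
theorem hasDerivAt_det_add_smul {M H : Matrix ι ι ℝ} {t : ℝ} (hM : (M + t • H).det ≠ 0) :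
    HasDerivAt (fun s : ℝ => (M + s • H).det)
      ((M + t • H).det * ((M + t • H)⁻¹ * H).trace) t := by
  set N := M + t • H with hN
  have hu := isUnit_iff_ne_zero.2 hM
  have h1 : ∀ s : ℝ, (M + s • H).det = N.det *
      (Polynomial.eval (s - t) (det (1 + (Polynomial.X : Polynomial ℝ) •
        (N⁻¹ * H).map Polynomial.C))) := fun s => by
    -- Factoring out `N` reduces the derivative to the linear coefficient of `det (1 + X K)`, which
    -- is the trace of `K`.
    have h2 : M + s • H = N * (1 + (s - t) • (N⁻¹ * H)) := by
      rw [Matrix.mul_add, Matrix.mul_one, Matrix.mul_smul, ← Matrix.mul_assoc,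
        mul_nonsing_inv _ hu, Matrix.one_mul, hN, sub_smul]
      abel
    rw [h2, det_mul]
    congr 1
    rw [← Polynomial.coe_evalRingHom, RingHom.map_det]
    congr 1
    generalize N⁻¹ * H = K
    ext i j
    simp [one_apply, apply_ite]
    exact mul_comm _ _
  simp_rw [h1]
  refine HasDerivAt.const_mul _ ?_
  have h3 := (Polynomial.hasDerivAt (det (1 + (Polynomial.X : Polynomial ℝ) •
        (N⁻¹ * H).map Polynomial.C)) (t - t)).comp_sub_const t t
  rwa [sub_self, derivative_det_one_add_X_smul] at h3

end LinearAlgebra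

/-! ### `S_k` as a sum of principal minors, and the growth of its logarithm. -/

section ElementarySymmetric

/-- By Vieta, both sides are, up to the same sign `(-1)^k`, the coefficient of degree `n - k` of the
characteristic polynomial. -/
theorem Sk_eq_sum_minors {n k : ℕ} (hk : k ≤ n) (R : Matrix (Fin n) (Fin n) ℝ) :
    Sk k R = ∑ s ∈ Finset.univ.powersetCard k,
      (R.submatrix (Subtype.val : s → Fin n) (Subtype.val : s → Fin n)).det := by
  set p := (R.map Complex.ofReal).charpoly with hp
  have hdeg : p.natDegree = n := by
    rw [hp, charpoly_natDegree_eq_dim, Fintype.card_fin]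
  have hroots : Multiset.card p.roots = p.natDegree :=
    Polynomial.splits_iff_card_roots.1 (IsAlgClosed.splits p)
  have h1 := Polynomial.coeff_eq_esymm_roots_of_card hroots (k := n - k) (by omega)
  have h2 := charpoly_coeff_eq_sum_minors R k (by simpa using hk)
  have h3 : p.coeff (n - k) = ((R.charpoly.coeff (n - k) : ℝ) : ℂ) := by
    have : p = R.charpoly.map Complex.ofRealHom := charpoly_map R Complex.ofRealHom
    rw [this, Polynomial.coeff_map]
    rfl
  rw [(charpoly_monic _).leadingCoeff, one_mul, hdeg, Nat.sub_sub_self hk] at h1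
  rw [Fintype.card_fin] at h2
  rw [h3, h2] at h1
  push_cast at h1
  have h4 := mul_left_cancel₀ (pow_ne_zero k (neg_ne_zero.2 (one_ne_zero' ℂ))) h1
  rw [Sk, ← hp, ← h4, ← Complex.ofReal_sum, Complex.ofReal_re]

theorem Sk_pos {n k : ℕ} (hk : k ≤ n) {R : Matrix (Fin n) (Fin n) ℝ} {c : ℝ} (hc : 0 < c)
    (hR : Coercive R c) : 0 < Sk k R := by
  rw [Sk_eq_sum_minors hk]
  refine Finset.sum_pos (fun s _ => (hR.submatrix Subtype.val_injective).det_pos hc) ?_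
  exact Finset.powersetCard_nonempty.2 (by simpa using hk)

/-- The increment of `log S_k` from `W₁ - β₁` to `W₂ - β₂` is estimated from below in terms of a
decomposition of the increment of the matrix. -/
theorem le_log_Sk_sub_log_Sk {n k : ℕ} (hk0 : 0 < k) (hk : k ≤ n)
    {W₁ W₂ b₁ b₂ P Γ N : Matrix (Fin n) (Fin n) ℝ} {c δ g m s e : ℝ}
    (hc : 0 < c) (hδ : 0 < δ) (hδ1 : δ < 1) (hm : 0 < m) (hs : 0 ≤ s) (hg : 0 < g)
    (hW₁ : W₁ᵀ = W₁) (hW₂ : W₂ᵀ = W₂) (hcW₁ : Coercive W₁ c) (hcW₂ : Coercive W₂ c)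
    (hb₁ : b₁ᵀ = -b₁) (hb₂ : b₂ᵀ = -b₂)
    (hbb₁ : BilinBound b₁ (δ * c)) (hbb₂ : BilinBound b₂ (δ * c))
    (hm₁ : ∀ i j, |(W₁ - b₁) i j| ≤ m) (hm₂ : ∀ i j, |(W₂ - b₂) i j| ≤ m)
    (hP : P.PosSemidef) (hΓ : Γᵀ = -Γ) (hbΓ : BilinBound Γ g) (hN : ∀ i j, |N i j| ≤ e)
    (hdecomp : (W₂ - b₂) - (W₁ - b₁) = P + s • (Matrix.of fun _ _ => (1 : ℝ)) - Γ + N) :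
    s * (c / (k * m ^ 2)) - k * (δ / ((1 + δ ^ 2) * c) * g) - k ^ 2 * e / c ≤
      Real.log (Sk k (W₂ - b₂)) - Real.log (Sk k (W₁ - b₁)) := by
  set H := (W₂ - b₂) - (W₁ - b₁) with hH
  set R : ℝ → Matrix (Fin n) (Fin n) ℝ := fun t => (W₁ - b₁) + t • H with hR
  set L := s * (c / (k * m ^ 2)) - k * (δ / ((1 + δ ^ 2) * c) * g) - k ^ 2 * e / c with hL
  have hRt : ∀ t, R t = (W₁ + t • (W₂ - W₁)) - (b₁ + t • (b₂ - b₁)) := fun t => by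
    simp only [hR, hH, smul_sub]
    abel
  have hskew : ∀ t : ℝ, (b₁ + t • (b₂ - b₁))ᵀ = -(b₁ + t • (b₂ - b₁)) := fun t => by
    rw [transpose_add, transpose_smul, transpose_sub, hb₁, hb₂]
    simp only [smul_sub, smul_neg]
    abel
  have hsymm : ∀ t : ℝ, (W₁ + t • (W₂ - W₁))ᵀ = W₁ + t • (W₂ - W₁) := fun t => by
    rw [transpose_add, transpose_smul, transpose_sub, hW₁, hW₂]
  have hcR : ∀ t ∈ Set.Icc (0 : ℝ) 1, Coercive (R t) c := fun t ht => by
    rw [hRt]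
    exact (hcW₁.convex_comb hcW₂ ht.1 ht.2).sub_skew (hskew t)
  have hmR : ∀ t ∈ Set.Icc (0 : ℝ) 1, ∀ i j, |R t i j| ≤ m := fun t ht i j => by
    have h1 : R t i j = (1 - t) * (W₁ - b₁) i j + t * (W₂ - b₂) i j := by
      simp only [hR, hH, Matrix.add_apply, Matrix.smul_apply, Matrix.sub_apply, smul_eq_mul]
      ring
    rw [h1]
    calc _ ≤ |(1 - t) * (W₁ - b₁) i j| + |t * (W₂ - b₂) i j| := abs_add_le _ _
      _ = (1 - t) * |(W₁ - b₁) i j| + t * |(W₂ - b₂) i j| := by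
          rw [abs_mul, abs_mul, abs_of_nonneg ht.1, abs_of_nonneg (sub_nonneg.2 ht.2)]
      _ ≤ (1 - t) * m + t * m := by
          have h2 := mul_le_mul_of_nonneg_left (hm₁ i j) (sub_nonneg.2 ht.2)
          have h3 := mul_le_mul_of_nonneg_left (hm₂ i j) ht.1
          linarith
      _ = m := by ring
  set d : ℝ → Finset (Fin n) → ℝ := fun t I =>
    ((R t).submatrix (Subtype.val : I → Fin n) (Subtype.val : I → Fin n)).det with hd
  set τ : ℝ → Finset (Fin n) → ℝ := fun t I =>
    (((R t).submatrix (Subtype.val : I → Fin n) (Subtype.val : I → Fin n))⁻¹ *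
      H.submatrix (Subtype.val : I → Fin n) (Subtype.val : I → Fin n)).trace with hτ
  have hdpos : ∀ t ∈ Set.Icc (0 : ℝ) 1, ∀ I, 0 < d t I := fun t ht I =>
    ((hcR t ht).submatrix Subtype.val_injective).det_pos hc
  have hderiv : ∀ t ∈ Set.Icc (0 : ℝ) 1, HasDerivAt (fun t => Sk k (R t))
      (∑ I ∈ Finset.univ.powersetCard k, d t I * τ t I) t := fun t ht => by
    simp_rw [Sk_eq_sum_minors hk]
    refine HasDerivAt.fun_sum fun I _ => ?_
    exact hasDerivAt_det_add_smul
      (M := (W₁ - b₁).submatrix (Subtype.val : I → Fin n) (Subtype.val : I → Fin n))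
      (H := H.submatrix (Subtype.val : I → Fin n) (Subtype.val : I → Fin n)) (hdpos t ht I).ne'
  have hSpos : ∀ t ∈ Set.Icc (0 : ℝ) 1, 0 < Sk k (R t) := fun t ht => Sk_pos hk hc (hcR t ht)
  -- Every minor separately satisfies the bound. The matrix of ones matters here: all its principal
  -- submatrices are again matrices of ones, so no minor misses the positive contribution.
  have hτL : ∀ t ∈ Set.Icc (0 : ℝ) 1, ∀ I ∈ Finset.univ.powersetCard k, L ≤ τ t I := by
    intro t ht I hI
    have hcard : Fintype.card I = k := by
      rw [Fintype.card_coe, (Finset.mem_powersetCard.1 hI).2]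
    have hinj : Function.Injective (Subtype.val : I → Fin n) := Subtype.val_injective
    have hc' := (hcR t ht).submatrix hinj
    have t1 := hc'.trace_inv_mul_posSemidef_nonneg hc (hP.submatrix (Subtype.val : I → Fin n))
    have t2 := hc'.le_trace_inv_mul_ones hc (fun i j => hmR t ht i j) hm (by rw [hcard]; exact hk0)
    have t3 := hc'.neg_le_trace_inv_mul hc
      (N := N.submatrix (Subtype.val : I → Fin n) (Subtype.val : I → Fin n)) (e := e)
      (fun i j => hN i j)
    have t4 := trace_inv_mul_skew_le hc hδ hδ1
      (W := (W₁ + t • (W₂ - W₁)).submatrix (Subtype.val : I → Fin n) (Subtype.val : I → Fin n))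
      (β := (b₁ + t • (b₂ - b₁)).submatrix (Subtype.val : I → Fin n) (Subtype.val : I → Fin n))
      (Γ := Γ.submatrix (Subtype.val : I → Fin n) (Subtype.val : I → Fin n))
      (by rw [transpose_submatrix, hsymm])
      ((hcW₁.convex_comb hcW₂ ht.1 ht.2).submatrix hinj)
      (by rw [transpose_submatrix, hskew]; rfl)
      ((hbb₁.convex_comb hbb₂ ht.1 ht.2).submatrix hinj)
      (by rw [transpose_submatrix, hΓ]; rfl) hg (hbΓ.submatrix hinj)
    have e1 : (W₁ + t • (W₂ - W₁)).submatrix (Subtype.val : I → Fin n) (Subtype.val : I → Fin n) -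
        (b₁ + t • (b₂ - b₁)).submatrix (Subtype.val : I → Fin n) (Subtype.val : I → Fin n) =
        (R t).submatrix (Subtype.val : I → Fin n) (Subtype.val : I → Fin n) := by
      rw [hRt]; rfl
    have e2 : H.submatrix (Subtype.val : I → Fin n) (Subtype.val : I → Fin n) =
        P.submatrix (Subtype.val : I → Fin n) (Subtype.val : I → Fin n) +
        s • (Matrix.of fun _ _ => (1 : ℝ)) -
        Γ.submatrix (Subtype.val : I → Fin n) (Subtype.val : I → Fin n) +
        N.submatrix (Subtype.val : I → Fin n) (Subtype.val : I → Fin n) := by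
      rw [hdecomp]; rfl
    rw [e1] at t4
    rw [hcard] at t2 t3 t4
    have t5 := mul_le_mul_of_nonneg_left t2 hs
    simp only [hτ]
    rw [e2, Matrix.mul_add, Matrix.mul_sub, Matrix.mul_add, Matrix.mul_smul, trace_add, trace_sub,
      trace_add, trace_smul, smul_eq_mul]
    linarith
  have hlog : ∀ t ∈ Set.Icc (0 : ℝ) 1, HasDerivAt (fun t => Real.log (Sk k (R t)))
      ((∑ I ∈ Finset.univ.powersetCard k, d t I * τ t I) / Sk k (R t)) t := fun t ht =>
    (hderiv t ht).log (hSpos t ht).ne'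
  obtain ⟨t, ht, hslope⟩ := exists_hasDerivAt_eq_slope _ _ (zero_lt_one' ℝ)
    (fun t ht => (hlog t ht).continuousAt.continuousWithinAt)
    (fun t ht => hlog t (Set.Ioo_subset_Icc_self ht))
  have ht' := Set.Ioo_subset_Icc_self ht
  have hR0 : R 0 = W₁ - b₁ := by simp [hR]
  have hR1 : R 1 = W₂ - b₂ := by simp [hR, hH]
  rw [hR0, hR1, sub_zero, div_one] at hslope
  -- The logarithmic derivative is the mean of the `τ t I` with positive weights `d t I`, whose sum
  -- is `S_k`.
  rw [← hslope, le_div_iff₀ (hSpos t ht'), Sk_eq_sum_minors hk, Finset.mul_sum]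
  refine Finset.sum_le_sum fun I hI => ?_
  rw [mul_comm]
  exact mul_le_mul_of_nonneg_left (hτL t ht' I hI) (hdpos t ht' I).le

end ElementarySymmetric

/-! ### From operator norms and least eigenvalues to bounds on forms. -/

section MatrixBounds

theorem dotProduct_mulVec_le_opNorm {n : ℕ} (M : Matrix (Fin n) (Fin n) ℝ) (p q : Fin n → ℝ) :
    p ⬝ᵥ M *ᵥ q ≤ opNorm M * (‖WithLp.toLp 2 p‖ * ‖WithLp.toLp 2 q‖) := by
  have h1 : p ⬝ᵥ M *ᵥ q = inner ℝ (WithLp.toLp 2 p)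
      (Matrix.toEuclideanCLM (n := Fin n) (𝕜 := ℝ) M (WithLp.toLp 2 q)) := by
    rw [Matrix.toEuclideanCLM_toLp, EuclideanSpace.inner_toLp_toLp, dotProduct_comm]
    rfl
  rw [h1]
  calc _ ≤ ‖WithLp.toLp 2 p‖ * ‖Matrix.toEuclideanCLM (n := Fin n) (𝕜 := ℝ) M (WithLp.toLp 2 q)‖ :=
        real_inner_le_norm _ _
    _ ≤ ‖WithLp.toLp 2 p‖ * (opNorm M * ‖WithLp.toLp 2 q‖) := by
        gcongr
        exact ContinuousLinearMap.le_opNorm _ _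
    _ = _ := by ring

theorem norm_toLp_sq {n : ℕ} (p : Fin n → ℝ) : ‖WithLp.toLp 2 p‖ ^ 2 = p ⬝ᵥ p := by
  rw [EuclideanSpace.real_norm_sq_eq]
  simp [dotProduct, pow_two]

theorem opNorm_nonneg {n : ℕ} (M : Matrix (Fin n) (Fin n) ℝ) : 0 ≤ opNorm M := norm_nonneg _

theorem two_mul_dotProduct_mulVec_le {n : ℕ} {M : Matrix (Fin n) (Fin n) ℝ} {c : ℝ}
    (h : opNorm M ≤ c) (p q : Fin n → ℝ) :
    2 * (p ⬝ᵥ M *ᵥ q) ≤ c * (p ⬝ᵥ p + q ⬝ᵥ q) := by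
  have h1 := dotProduct_mulVec_le_opNorm M p q
  have h2 := two_mul_le_add_sq ‖WithLp.toLp 2 p‖ ‖WithLp.toLp 2 q‖
  rw [norm_toLp_sq, norm_toLp_sq] at h2
  have h3 : opNorm M * (2 * ‖WithLp.toLp 2 p‖ * ‖WithLp.toLp 2 q‖) ≤ c * (p ⬝ᵥ p + q ⬝ᵥ q) := by
    apply mul_le_mul h h2 (by positivity) ((opNorm_nonneg M).trans h)
  linarith

theorem bilinBound_of_opNorm_le {n : ℕ} {M : Matrix (Fin n) (Fin n) ℝ} {c : ℝ}
    (h : opNorm M ≤ c) : BilinBound M c := two_mul_dotProduct_mulVec_le h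

/-- The operator norm is bounded in terms of a bound of the entries. -/
theorem opNorm_le_of_abs_le {n : ℕ} {M : Matrix (Fin n) (Fin n) ℝ} {c : ℝ} (hc : 0 ≤ c)
    (h : ∀ i j, |M i j| ≤ c) : opNorm M ≤ n * c := by
  refine ContinuousLinearMap.opNorm_le_bound _ (by positivity) fun x => ?_
  refine abs_le_of_sq_le_sq' ?_ (by positivity) |>.2
  rw [EuclideanSpace.real_norm_sq_eq, mul_pow, EuclideanSpace.real_norm_sq_eq x]
  have hrow : ∀ i, (Matrix.toEuclideanCLM (n := Fin n) (𝕜 := ℝ) M x) i ^ 2 ≤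
      n * c ^ 2 * ∑ j, x j ^ 2 := fun i => by
    have h1 : (Matrix.toEuclideanCLM (n := Fin n) (𝕜 := ℝ) M x) i = ∑ j, M i j * x j := by
      rw [Matrix.ofLp_toEuclideanCLM]
      rfl
    rw [h1]
    refine (Finset.sum_mul_sq_le_sq_mul_sq _ _ _).trans ?_
    gcongr
    calc ∑ j, M i j ^ 2 ≤ ∑ _j : Fin n, c ^ 2 := Finset.sum_le_sum fun j _ => by
          rw [← sq_abs]
          exact pow_le_pow_left₀ (abs_nonneg _) (h i j) 2
      _ = _ := by simp
  refine (Finset.sum_le_sum fun i _ => hrow i).trans (le_of_eq ?_)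
  simp
  ring

theorem coercive_of_le_lambdaMin {n : ℕ} {W : Matrix (Fin n) (Fin n) ℝ} (hW : Wᵀ = W) {c : ℝ}
    (h : c ≤ lambdaMin W) : Coercive W c := by
  have hP : (W - c • (1 : Matrix (Fin n) (Fin n) ℝ)).PosSemidef := by
    rw [posSemidef_iff_isHermitian_and_spectrum_nonneg]
    refine ⟨?_, fun a ha => ?_⟩
    · rw [IsHermitian, conjTranspose_eq_transpose_of_trivial]
      simp [hW]
    · rw [← Algebra.algebraMap_eq_smul_one, ← spectrum.sub_singleton_eq] at ha
      obtain ⟨b, hb, d, hd, rfl⟩ := ha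
      rw [Set.mem_singleton_iff.1 hd]
      have : lambdaMin W ≤ b := csInf_le (finite_real_spectrum (𝕜 := ℝ)).bddBelow hb
      exact sub_nonneg.2 (h.trans this)
  intro x
  have := hP.dotProduct_mulVec_nonneg x
  simp only [star_trivial, sub_mulVec, dotProduct_sub, smul_mulVec, one_mulVec, dotProduct_smul,
    smul_eq_mul] at this
  linarith

end MatrixBounds

/-! ### Geometry at the boundary: inward directions and unique differentiability. -/

section Domain

open Filter Topology

theorem IsLocalDefiningFunction.eventually_mem {n : ℕ} {Ω U : Set (E n)} {x₀ y : E n}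
    {ρ : E n → ℝ} (h : IsLocalDefiningFunction Ω x₀ U ρ) (hy : 0 < inner ℝ (gradient ρ x₀) y) :
    ∀ᶠ t : ℝ in 𝓝[>] 0, x₀ + t • y ∈ Ω := by
  have hU : U ∈ 𝓝 x₀ := h.isOpen.mem_nhds h.mem
  have hd : HasFDerivAt ρ (fderiv ℝ ρ x₀) x₀ :=
    ((h.smooth.contDiffAt hU).differentiableAt (by simp)).hasFDerivAt
  have hl : HasDerivAt (fun t : ℝ => x₀ + t • y) y 0 := by
    simpa using ((hasDerivAt_id (0 : ℝ)).smul_const y).const_add x₀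
  have hc := hd.comp_hasDerivAt_of_eq (0 : ℝ) hl (by simp)
  rw [← inner_gradient_left] at hc
  have hslope := (hasDerivAt_iff_tendsto_slope.1 hc).mono_left
    (nhdsWithin_mono (0 : ℝ) (fun t (ht : 0 < t) => ht.ne') : 𝓝[>] (0 : ℝ) ≤ _)
  have hmem : ∀ᶠ t : ℝ in 𝓝[>] 0, x₀ + t • y ∈ U := by
    refine Filter.Eventually.filter_mono nhdsWithin_le_nhds ?_
    refine hl.continuousAt.eventually_mem ?_
    simpa using hU
  filter_upwards [hslope.eventually (lt_mem_nhds hy), hmem, self_mem_nhdsWithin]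
    with t ht htU ht0
  have ht0' : (0 : ℝ) < t := ht0
  rw [h.mem_iff _ htU]
  rw [slope_def_field] at ht
  simp only [Function.comp_apply, zero_smul, add_zero, h.zero, sub_zero] at ht
  exact (div_pos_iff_of_pos_right ht0').1 ht

/-- At a boundary point the tangent cone contains the open half-space on the side of the gradient of
`ρ`, and this spans. It makes the derivatives within the closure well determined. -/
theorem IsBoundedSmoothDomain.uniqueDiffOn {n : ℕ} {Ω : Set (E n)}
    (hΩ : IsBoundedSmoothDomain Ω) : UniqueDiffOn ℝ (closure Ω) := by
  intro x hx
  rw [uniqueDiffWithinAt_closure]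
  by_cases hxΩ : x ∈ Ω
  · exact hΩ.isOpen.uniqueDiffWithinAt hxΩ
  obtain ⟨U, ρ, h⟩ := hΩ.smooth_boundary x (by
    rw [frontier, hΩ.isOpen.interior_eq]
    exact ⟨hx, hxΩ⟩)
  have hpos : 0 < inner ℝ (gradient ρ x) (gradient ρ x) := by
    rw [real_inner_self_eq_norm_sq]
    have := norm_pos_iff.2 h.gradient_ne_zero
    positivity
  have hcone : ∀ y, 0 < inner ℝ (gradient ρ x) y → y ∈ tangentConeAt ℝ Ω x := fun y hy =>
    mem_tangentConeAt_of_add_smul_mem (l := 𝓝[>] (0 : ℝ)) (c := id)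
      (tendsto_id.mono_left (nhdsWithin_mono _ fun t (ht : 0 < t) => ht.ne')) (h.eventually_mem hy)
  rw [uniqueDiffWithinAt_iff]
  refine ⟨?_, hx⟩
  have htop : Submodule.span ℝ (tangentConeAt ℝ Ω x) = ⊤ := by
    rw [eq_top_iff]
    intro y _
    -- Large enough that `y + c • gradient ρ x` lies in the half-space, so `y` is a difference of
    -- two vectors of the span.
    set c : ℝ := (|inner ℝ (gradient ρ x) y| + 1) / inner ℝ (gradient ρ x) (gradient ρ x) with hc
    have h1 : y + c • gradient ρ x ∈ tangentConeAt ℝ Ω x := by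
      apply hcone
      rw [inner_add_right, inner_smul_right, hc, div_mul_cancel₀ _ hpos.ne']
      have := neg_abs_le (inner ℝ (gradient ρ x) y)
      linarith
    have h2 := Submodule.sub_mem _ (Submodule.subset_span h1)
      (Submodule.smul_mem _ c (Submodule.subset_span (hcone _ hpos)))
    simpa using h2
  rw [htop]
  simp

theorem dom_eq_prod {n : ℕ} (Ω : Set (E n)) : dom Ω = closure Ω ×ˢ Set.univ := by
  ext q
  simp [dom]

theorem IsBoundedSmoothDomain.uniqueDiffOn_dom {n : ℕ} {Ω : Set (E n)}
    (hΩ : IsBoundedSmoothDomain Ω) : UniqueDiffOn ℝ (dom Ω) := by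
  rw [dom_eq_prod]
  exact hΩ.uniqueDiffOn.prod uniqueDiffOn_univ

theorem IsBoundedSmoothDomain.isCompact_closure {n : ℕ} {Ω : Set (E n)}
    (hΩ : IsBoundedSmoothDomain Ω) : IsCompact (closure Ω) :=
  hΩ.isBounded.isCompact_closure

/-- Ordering in the domain together with equality at a boundary point orders the normal
derivatives there. -/
theorem normalDeriv_le_of_le {n : ℕ} {Ω : Set (E n)} {u v : E n → ℝ} (hu : IsC2 Ω u)
    (hv : IsC2 Ω v) (hle : ∀ x ∈ Ω, v x ≤ u x) {x ν : E n} (hx : x ∈ frontier Ω)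
    (huv : u x = v x) (hν : IsInwardUnitNormal Ω x ν) :
    normalDeriv Ω v x ν ≤ normalDeriv Ω u x ν := by
  obtain ⟨U, ρ, h, rfl⟩ := hν
  set ν := ‖gradient ρ x‖⁻¹ • gradient ρ x with hν
  have hpos : 0 < inner ℝ (gradient ρ x) ν := by
    rw [hν, inner_smul_right, real_inner_self_eq_norm_sq]
    have := norm_pos_iff.2 h.gradient_ne_zero
    positivity
  have hmem := h.eventually_mem hpos
  have hxc : x ∈ closure Ω := frontier_subset_closure hx
  have hdu := ((hu.differentiableOn (by simp)) x hxc).hasFDerivWithinAt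
  have hdv := ((hv.differentiableOn (by simp)) x hxc).hasFDerivWithinAt
  have hw := hdu.sub hdv
  have hlim := hw.lim (l := 𝓝[>] (0 : ℝ)) (c := fun t => t⁻¹) (d := fun t => t • ν) (v := ν)
    (by
      have : Tendsto (fun t : ℝ => t • ν) (𝓝 0) (𝓝 0) := by
        have := (by fun_prop : Continuous fun t : ℝ => t • ν).tendsto 0
        simpa using this
      exact this.mono_left nhdsWithin_le_nhds)
    (hmem.mono fun t ht => subset_closure ht)
    (by
      refine tendsto_nhds_of_eventually_eq ?_
      filter_upwards [self_mem_nhdsWithin] with t ht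
      rw [smul_smul, inv_mul_cancel₀ (ne_of_gt ht), one_smul])
  have hge := ge_of_tendsto (b := 0) hlim (by
    filter_upwards [hmem, self_mem_nhdsWithin] with t ht ht0
    have h1 := hle _ ht
    have h2 : (0 : ℝ) < t := ht0
    simp only [Pi.sub_apply, huv, sub_self, sub_zero, smul_eq_mul]
    exact mul_nonneg (inv_nonneg.2 h2.le) (sub_nonneg.2 h1))
  rw [normalDeriv, normalDeriv, grad, grad, inner_gradientWithin_left, inner_gradientWithin_left]
  exact sub_nonneg.1 hge

end Domain

/-! ### First and second order conditions at an interior minimum. -/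

section Interior

open Filter Topology

variable {n : ℕ} {Ω : Set (E n)} {u : E n → ℝ}

theorem sum_smul_basisVec (y : E n) : ∑ i, y i • (basisVec i : E n) = y := by
  have := (EuclideanSpace.basisFun (Fin n) ℝ).sum_repr y
  simpa [basisVec] using this

theorem hess_quadratic (y : E n) (x : E n) :
    y.ofLp ⬝ᵥ hess Ω u x *ᵥ y.ofLp =
      fderivWithin ℝ (fderivWithin ℝ u (closure Ω)) (closure Ω) x y y := by
  conv_rhs => rw [← sum_smul_basisVec y]
  simp only [map_sum, map_smul, _root_.sum_apply, _root_.smul_apply,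
    smul_eq_mul, dotProduct, mulVec, hess, Matrix.of_apply, Finset.mul_sum]
  rw [Finset.sum_comm]
  refine Finset.sum_congr rfl fun i _ => Finset.sum_congr rfl fun j _ => ?_
  ring

theorem hess_transpose (hΩ : IsBoundedSmoothDomain Ω) (hu : IsC2 Ω u) {x : E n} (hx : x ∈ Ω) :
    (hess Ω u x)ᵀ = hess Ω u x := by
  have hxc := subset_closure hx
  have h := (hu x hxc).isSymmSndFDerivWithinAt (by simp) hΩ.uniqueDiffOn
    (subset_closure (interior_mono subset_closure (by rwa [hΩ.isOpen.interior_eq]))) hxc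
  ext i j
  exact h _ _

theorem hasDerivAt_line (x y : E n) (t : ℝ) : HasDerivAt (fun t : ℝ => x + t • y) y t := by
  simpa using ((hasDerivAt_id t).smul_const y).const_add x

theorem eventually_hasDerivAt_line (hΩ : IsOpen Ω) (hu : IsC2 Ω u) {x : E n} (hx : x ∈ Ω)
    (y : E n) : ∀ᶠ t : ℝ in 𝓝 0,
      HasDerivAt (fun t : ℝ => u (x + t • y)) (fderivWithin ℝ u (closure Ω) (x + t • y) y) t := by
  have hmem : ∀ᶠ t : ℝ in 𝓝 0, x + t • y ∈ Ω :=
    (hasDerivAt_line x y 0).continuousAt.eventually_mem (by simpa using hΩ.mem_nhds hx)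
  filter_upwards [hmem] with t ht
  have hd := ((hu.differentiableOn (by simp)) _ (subset_closure ht)).hasFDerivWithinAt.hasFDerivAt
    (mem_of_superset (hΩ.mem_nhds ht) subset_closure)
  exact hd.comp_hasDerivAt t (hasDerivAt_line x y t)

theorem hasDerivAt_fderivWithin_line (hΩ : IsBoundedSmoothDomain Ω) (hu : IsC2 Ω u) {x : E n}
    (hx : x ∈ Ω) (y : E n) :
    HasDerivAt (fun t : ℝ => fderivWithin ℝ u (closure Ω) (x + t • y) y)
      (y.ofLp ⬝ᵥ hess Ω u x *ᵥ y.ofLp) 0 := by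
  have hC1 : ContDiffOn ℝ 1 (fderivWithin ℝ u (closure Ω)) (closure Ω) :=
    hu.fderivWithin hΩ.uniqueDiffOn (by norm_num)
  have hd := ((hC1.differentiableOn (by simp)) _ (subset_closure hx)).hasFDerivWithinAt.hasFDerivAt
    (mem_of_superset (hΩ.isOpen.mem_nhds hx) subset_closure)
  have h1 := hd.comp_hasDerivAt_of_eq (0 : ℝ) (hasDerivAt_line x y 0) (by simp)
  rw [hess_quadratic]
  exact h1.clm_apply (hasDerivAt_const (0 : ℝ) y) |>.congr_deriv (by simp)

/-- The necessary conditions of first and second order at a local minimum. -/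
theorem isLocalMin_second_order {g g' : ℝ → ℝ} {c : ℝ} (hmin : IsLocalMin g 0)
    (hg : ∀ᶠ t in 𝓝 0, HasDerivAt g (g' t) t) (hg' : HasDerivAt g' c 0) : g' 0 = 0 ∧ 0 ≤ c := by
  have h0 : g' 0 = 0 := hmin.hasDerivAt_eq_zero hg.self_of_nhds
  refine ⟨h0, ?_⟩
  -- A negative second derivative would make `0` a local maximum as well, so `g` would be locally
  -- constant and its second derivative zero.
  by_contra! hc
  have heq : deriv g =ᶠ[𝓝 0] g' := hg.mono fun t ht => ht.deriv
  have hdd : deriv (deriv g) 0 = c := heq.deriv_eq.trans hg'.deriv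
  have hmax : IsLocalMax g 0 := isLocalMax_of_deriv_deriv_neg (by rwa [hdd])
    (by rw [heq.self_of_nhds, h0]) hg.self_of_nhds.continuousAt
  have hconst : g =ᶠ[𝓝 0] fun _ => g 0 := by
    filter_upwards [hmin, hmax] with t h1 h2 using le_antisymm h2 h1
  have hderiv : deriv g =ᶠ[𝓝 0] fun _ => 0 := by
    have := hconst.deriv
    simpa using this
  have : deriv (deriv g) 0 = 0 := by
    rw [hderiv.deriv_eq]
    simp
  linarith

/-- The vector with all coordinates equal to one. -/
def onesVec (n : ℕ) : E n := WithLp.toLp 2 fun _ => 1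

theorem inner_onesVec (x : E n) : inner ℝ (onesVec n) x = ∑ i, x i := by
  simp [onesVec, PiLp.inner_apply]

/-- The conditions at an interior minimum of `u - v - ε exp (γ (x₁ + ⋯ + xₙ))`. -/
theorem interior_min_conditions (hΩ : IsBoundedSmoothDomain Ω) {v : E n → ℝ} (hu : IsC2 Ω u)
    (hv : IsC2 Ω v) {ε γ : ℝ} {x : E n} (hx : x ∈ Ω)
    (hmin : ∀ y ∈ Ω, u x - v x - ε * Real.exp (γ * inner ℝ (onesVec n) x) ≤
      u y - v y - ε * Real.exp (γ * inner ℝ (onesVec n) y)) :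
    grad Ω u x - grad Ω v x = (ε * γ * Real.exp (γ * inner ℝ (onesVec n) x)) • onesVec n ∧
    (hess Ω u x - hess Ω v x - (ε * γ ^ 2 * Real.exp (γ * inner ℝ (onesVec n) x)) •
      (Matrix.of fun _ _ => (1 : ℝ))).PosSemidef := by
  have key : ∀ y : E n,
      fderivWithin ℝ u (closure Ω) x y - fderivWithin ℝ v (closure Ω) x y -
        ε * γ * Real.exp (γ * inner ℝ (onesVec n) x) * inner ℝ (onesVec n) y = 0 ∧
      0 ≤ y.ofLp ⬝ᵥ hess Ω u x *ᵥ y.ofLp - y.ofLp ⬝ᵥ hess Ω v x *ᵥ y.ofLp -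
        ε * γ ^ 2 * Real.exp (γ * inner ℝ (onesVec n) x) * (inner ℝ (onesVec n) y) ^ 2 := by
    intro y
    set s := inner ℝ (onesVec n) x with hs
    set r := inner ℝ (onesVec n) y with hr
    have hlin : ∀ t : ℝ, inner ℝ (onesVec n) (x + t • y) = s + t * r := fun t => by
      rw [inner_add_right, inner_smul_right]
    have hexp : ∀ t : ℝ, HasDerivAt (fun t : ℝ => Real.exp (γ * (s + t * r)))
        (γ * r * Real.exp (γ * (s + t * r))) t := fun t => by
      have := ((((hasDerivAt_id t).mul_const r).const_add s).const_mul γ).exp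
      refine this.congr_deriv ?_
      simp only [id]
      ring
    have hmem : ∀ᶠ t : ℝ in 𝓝 0, x + t • y ∈ Ω :=
      (hasDerivAt_line x y 0).continuousAt.eventually_mem
        (by simpa using hΩ.isOpen.mem_nhds hx)
    have h := isLocalMin_second_order
      (g := fun t => u (x + t • y) - v (x + t • y) - ε * Real.exp (γ * (s + t * r)))
      (g' := fun t => fderivWithin ℝ u (closure Ω) (x + t • y) y -
        fderivWithin ℝ v (closure Ω) (x + t • y) y - ε * (γ * r * Real.exp (γ * (s + t * r))))
      (c := y.ofLp ⬝ᵥ hess Ω u x *ᵥ y.ofLp - y.ofLp ⬝ᵥ hess Ω v x *ᵥ y.ofLp -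
        ε * (γ * r * (γ * r * Real.exp (γ * (s + 0 * r)))))
      (by
        filter_upwards [hmem] with t ht
        have := hmin _ ht
        rw [hlin] at this
        simpa [hs] using this)
      (by
        filter_upwards [eventually_hasDerivAt_line hΩ.isOpen hu hx y,
          eventually_hasDerivAt_line hΩ.isOpen hv hx y] with t h1 h2
        exact (h1.sub h2).sub ((hexp t).const_mul ε))
      (((hasDerivAt_fderivWithin_line hΩ hu hx y).sub
        (hasDerivAt_fderivWithin_line hΩ hv hx y)).sub (((hexp 0).const_mul (γ * r)).const_mul ε))
    simp only [zero_smul, add_zero, zero_mul] at h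
    refine ⟨?_, ?_⟩
    · rw [← h.1]; ring
    · refine h.2.trans (le_of_eq ?_); ring
  constructor
  · refine ext_inner_right ℝ fun y => ?_
    rw [inner_sub_left, inner_smul_left, grad, grad, inner_gradientWithin_left,
      inner_gradientWithin_left]
    have := (key y).1
    simp only [conj_trivial]
    linarith
  · refine PosSemidef.of_dotProduct_mulVec_nonneg ?_ fun y => ?_
    · rw [IsHermitian, conjTranspose_eq_transpose_of_trivial, transpose_sub, transpose_sub,
        hess_transpose hΩ hu hx, hess_transpose hΩ hv hx, transpose_smul]
      rfl
    · have h := (key (WithLp.toLp 2 y)).2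
      rw [inner_onesVec (WithLp.toLp 2 y)] at h
      have hJ : y ⬝ᵥ (Matrix.of fun _ _ => (1 : ℝ)) *ᵥ y = (∑ i, y i) ^ 2 := by
        simp [dotProduct, mulVec, ← Finset.sum_mul, pow_two]
      simp only [star_trivial, sub_mulVec, dotProduct_sub, smul_mulVec, dotProduct_smul, hJ,
        smul_eq_mul]
      exact h

end Interior

/-! ### Monotonicity and Lipschitz estimates for the coefficients. -/

section Coefficients

variable {n : ℕ} {Ω : Set (E n)}

theorem hasDerivAt_Dz {g : E n × ℝ × E n → ℝ} (hg : IsC1 Ω g) {x : E n} (hx : x ∈ closure Ω)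
    (z : ℝ) (p : E n) :
    HasDerivAt (fun t => g (x, t, p)) (Dz g (x, z, p)) z ∧
      Dz g (x, z, p) = fderivWithin ℝ g (dom Ω) (x, z, p) (0, 1, 0) := by
  have hd := ((hg.differentiableOn (by simp)) (x, z, p) hx).hasFDerivWithinAt
  have hl : HasDerivAt (fun t : ℝ => ((x, t, p) : E n × ℝ × E n)) (0, 1, 0) z :=
    (hasDerivAt_const z x).prodMk ((hasDerivAt_id z).prodMk (hasDerivAt_const z p))
  have h := hd.comp_hasDerivAt z hl (Filter.Eventually.of_forall fun _ => hx)
  have he : Dz g (x, z, p) = fderivWithin ℝ g (dom Ω) (x, z, p) (0, 1, 0) := h.deriv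
  exact ⟨he ▸ h, he⟩

theorem abs_Dz_le {g : E n × ℝ × E n → ℝ} (hg : IsC1 Ω g) {q : E n × ℝ × E n}
    (hq : q ∈ dom Ω) : |Dz g q| ≤ ‖fderivWithin ℝ g (dom Ω) q‖ := by
  obtain ⟨x, z, p⟩ := q
  rw [(hasDerivAt_Dz hg hq z p).2, ← Real.norm_eq_abs]
  refine (ContinuousLinearMap.le_opNorm _ _).trans (le_of_eq ?_)
  simp [Prod.norm_def]

theorem opNorm_le_mu {M : E n × ℝ × E n → Matrix (Fin n) (Fin n) ℝ}
    (hM : ∀ i j, ∃ C, ∀ q ∈ dom Ω, |M q i j| ≤ C) {q : E n × ℝ × E n} (hq : q ∈ dom Ω) :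
    opNorm (M q) ≤ mu Ω M := by
  choose C hC using hM
  refine le_csSup ⟨n * ∑ i, ∑ j, |C i j|, ?_⟩ ⟨q, hq, rfl⟩
  rintro _ ⟨r, hr, rfl⟩
  refine opNorm_le_of_abs_le (by positivity) fun i j => ?_
  calc |M r i j| ≤ |C i j| := (hC i j r hr).trans (le_abs_self _)
    _ ≤ ∑ j, |C i j| := Finset.single_le_sum (f := fun j => |C i j|) (fun _ _ => abs_nonneg _)
        (Finset.mem_univ j)
    _ ≤ ∑ i, ∑ j, |C i j| := Finset.single_le_sum (f := fun i => ∑ j, |C i j|)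
        (fun _ _ => Finset.sum_nonneg fun _ _ => abs_nonneg _) (Finset.mem_univ i)

/-- A real `sInf` of a set unbounded below is `0` by convention, so positivity already forces
boundedness below. -/
theorem lambdaInf_le {A : E n × ℝ × E n → Matrix (Fin n) (Fin n) ℝ} {u : E n → ℝ}
    (h : 0 < lambdaInf Ω A u) {x : E n} (hx : x ∈ closure Ω) :
    lambdaInf Ω A u ≤ lambdaMin (omega Ω A u x) := by
  refine csInf_le ?_ ⟨x, hx, rfl⟩
  by_contra hbdd
  rw [lambdaInf, Real.sInf_of_not_bddBelow hbdd] at h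
  exact lt_irrefl _ h

theorem hasDerivAt_dotProduct_mulVec {M : E n × ℝ × E n → Matrix (Fin n) (Fin n) ℝ}
    (hM : ∀ i j, IsC1 Ω fun q => M q i j) {x : E n} (hx : x ∈ closure Ω) (z : ℝ) (p : E n)
    (a b : Fin n → ℝ) :
    HasDerivAt (fun t => a ⬝ᵥ M (x, t, p) *ᵥ b) (a ⬝ᵥ DzMat M (x, z, p) *ᵥ b) z := by
  simp only [dotProduct, mulVec]
  refine HasDerivAt.fun_sum fun i _ => HasDerivAt.const_mul _ ?_
  refine HasDerivAt.fun_sum fun j _ => HasDerivAt.mul_const ?_ _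
  exact (hasDerivAt_Dz (hM i j) hx z p).1

theorem sub_posSemidef_of_Dz_posSemidef {A : E n × ℝ × E n → Matrix (Fin n) (Fin n) ℝ}
    (hA : ∀ i j, IsC1 Ω fun q => A q i j) (hA_symm : ∀ q ∈ dom Ω, (A q)ᵀ = A q)
    (hDzA : ∀ q ∈ dom Ω, (DzMat A q).PosSemidef) {x : E n} (hx : x ∈ closure Ω) (p : E n)
    {z₁ z₂ : ℝ} (hz : z₁ ≤ z₂) : (A (x, z₂, p) - A (x, z₁, p)).PosSemidef := by
  refine PosSemidef.of_dotProduct_mulVec_nonneg ?_ fun y => ?_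
  · rw [IsHermitian, conjTranspose_eq_transpose_of_trivial, transpose_sub,
      hA_symm (x, z₂, p) hx, hA_symm (x, z₁, p) hx]
  · have hd := fun t => hasDerivAt_dotProduct_mulVec hA hx t p y y
    have hmono : Monotone fun t => y ⬝ᵥ A (x, t, p) *ᵥ y :=
      monotone_of_deriv_nonneg (fun t => (hd t).differentiableAt) fun t => by
        rw [(hd t).deriv]
        simpa using (hDzA (x, t, p) hx).dotProduct_mulVec_nonneg y
    have := hmono hz
    simp only [star_trivial, sub_mulVec, dotProduct_sub]
    linarith

theorem bilinBound_sub_of_opNorm_Dz_le {B : E n × ℝ × E n → Matrix (Fin n) (Fin n) ℝ}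
    (hB : ∀ i j, IsC1 Ω fun q => B q i j) {c : ℝ}
    (hDzB : ∀ q ∈ dom Ω, opNorm (DzMat B q) ≤ c) {x : E n} (hx : x ∈ closure Ω) (p : E n)
    {z₁ z₂ : ℝ} (hz : z₁ ≤ z₂) :
    BilinBound (B (x, z₁, p) - B (x, z₂, p)) (c * (z₂ - z₁)) := fun a b => by
  have hd := fun t => hasDerivAt_dotProduct_mulVec hB hx t p a b
  have h := mul_sub_le_image_sub_of_le_deriv (f := fun t => a ⬝ᵥ B (x, t, p) *ᵥ b)
    (C := -(c * (a ⬝ᵥ a + b ⬝ᵥ b)) / 2) (fun t => (hd t).differentiableAt)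
    (fun t => by
      rw [(hd t).deriv]
      have := two_mul_dotProduct_mulVec_le (hDzB (x, t, p) hx) (-a) b
      simp only [neg_dotProduct, dotProduct_neg, neg_neg] at this
      linarith) hz
  simp only [sub_mulVec, dotProduct_sub]
  linarith

/-- A function of class `C¹(𝒟)` is Lipschitz in `p`, uniformly on bounded subsets. -/
theorem exists_lipschitz_gradient_variable {F : Type*} [NormedAddCommGroup F] [NormedSpace ℝ F]
    (hΩ : IsBoundedSmoothDomain Ω) {g : E n × ℝ × E n → F} (hg : ContDiffOn ℝ 1 g (dom Ω))
    (m : ℝ) : ∃ L : ℝ, 0 ≤ L ∧ ∀ x ∈ closure Ω, ∀ z : ℝ, ‖z‖ ≤ m → ∀ p p' : E n, ‖p‖ ≤ m →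
      ‖p'‖ ≤ m → ‖g (x, z, p) - g (x, z, p')‖ ≤ L * ‖p - p'‖ := by
  set K : Set (E n × ℝ × E n) :=
    closure Ω ×ˢ (Metric.closedBall 0 m ×ˢ Metric.closedBall 0 m) with hK
  have hKc : IsCompact K := hΩ.isCompact_closure.prod
    ((isCompact_closedBall _ _).prod (isCompact_closedBall _ _))
  have hKd : K ⊆ dom Ω := fun q hq => hq.1
  obtain ⟨L, hL⟩ := hKc.exists_bound_of_continuousOn
    ((hg.continuousOn_fderivWithin hΩ.uniqueDiffOn_dom (by simp)).mono hKd)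
  refine ⟨|L|, abs_nonneg _, fun x hx z hz p p' hp hp' => ?_⟩
  -- Only `p` varies, within a ball, so the mean value inequality needs no convexity of `Ω`.
  have hderiv : ∀ r ∈ Metric.closedBall (0 : E n) m,
      HasFDerivWithinAt (fun r => g (x, z, r))
        ((fderivWithin ℝ g (dom Ω) (x, z, r)).comp
          ((ContinuousLinearMap.inr ℝ (E n) (ℝ × E n)).comp (ContinuousLinearMap.inr ℝ ℝ (E n))))
        (Metric.closedBall 0 m) r := fun r _ => by
    have hd := ((hg.differentiableOn (by simp)) (x, z, r) hx).hasFDerivWithinAt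
    have hl : HasFDerivWithinAt (fun r : E n => ((x, z, r) : E n × ℝ × E n))
        ((ContinuousLinearMap.inr ℝ (E n) (ℝ × E n)).comp (ContinuousLinearMap.inr ℝ ℝ (E n)))
        (Metric.closedBall 0 m) r :=
      ((hasFDerivWithinAt_const x r _).prodMk
        ((hasFDerivWithinAt_const z r _).prodMk (hasFDerivWithinAt_id r _))).congr_fderiv rfl
    exact hd.comp r hl fun _ _ => hx
  refine (convex_closedBall (0 : E n) m).norm_image_sub_le_of_norm_hasFDerivWithin_le hderiv
    (fun r hr => ?_) (by simpa using hp') (by simpa using hp)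
  refine (ContinuousLinearMap.opNorm_comp_le _ _).trans ?_
  calc _ ≤ |L| * 1 := by
        gcongr
        · exact (hL (x, z, r) ⟨hx, by simpa using hz, hr⟩).trans (le_abs_self L)
        · refine ContinuousLinearMap.opNorm_le_bound _ zero_le_one fun y => ?_
          simp [Prod.norm_def]
    _ = |L| := mul_one _

theorem exists_lipschitz_gradient_variable_matrix (hΩ : IsBoundedSmoothDomain Ω)
    {M : E n × ℝ × E n → Matrix (Fin n) (Fin n) ℝ} (hM : ∀ i j, IsC1 Ω fun q => M q i j)
    (m : ℝ) : ∃ L : ℝ, 0 ≤ L ∧ ∀ x ∈ closure Ω, ∀ z : ℝ, ‖z‖ ≤ m → ∀ p p' : E n, ‖p‖ ≤ m →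
      ‖p'‖ ≤ m → ∀ i j, |M (x, z, p) i j - M (x, z, p') i j| ≤ L * ‖p - p'‖ := by
  obtain ⟨L, hL0, hL⟩ := exists_lipschitz_gradient_variable hΩ
    (g := fun q => (fun i j => M q i j : Fin n → Fin n → ℝ))
    (contDiffOn_pi.2 fun i => contDiffOn_pi.2 fun j => hM i j) m
  refine ⟨L, hL0, fun x hx z hz p p' hp hp' i j => le_trans ?_ (hL x hx z hz p p' hp hp')⟩
  have h1 := norm_le_pi_norm ((fun i j => M (x, z, p) i j : Fin n → Fin n → ℝ) -
    fun i j => M (x, z, p') i j) i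
  have h2 := norm_le_pi_norm (((fun i j => M (x, z, p) i j : Fin n → Fin n → ℝ) -
    fun i j => M (x, z, p') i j) i) j
  exact h2.trans h1

end Coefficients

/-! ### Compactness bounds and existence of the interior minimum. -/

section Bounds

variable {n : ℕ} {Ω : Set (E n)} {u : E n → ℝ}

theorem continuousOn_grad (hΩ : IsBoundedSmoothDomain Ω) (hu : IsC2 Ω u) :
    ContinuousOn (grad Ω u) (closure Ω) :=
  (LinearIsometryEquiv.continuous _).comp_continuousOn
    (hu.continuousOn_fderivWithin hΩ.uniqueDiffOn (by norm_num))

theorem continuousOn_hess (hΩ : IsBoundedSmoothDomain Ω) (hu : IsC2 Ω u) (i j : Fin n) :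
    ContinuousOn (fun x => hess Ω u x i j) (closure Ω) := by
  have h1 : ContDiffOn ℝ 1 (fderivWithin ℝ u (closure Ω)) (closure Ω) :=
    hu.fderivWithin hΩ.uniqueDiffOn (by norm_num)
  have h2 := h1.continuousOn_fderivWithin hΩ.uniqueDiffOn (by simp)
  exact (h2.clm_apply continuousOn_const).clm_apply continuousOn_const

theorem continuousOn_comp_jet (hΩ : IsBoundedSmoothDomain Ω) (hu : IsC2 Ω u)
    {g : E n × ℝ × E n → ℝ} (hg : IsC1 Ω g) :
    ContinuousOn (fun x => g (x, u x, grad Ω u x)) (closure Ω) :=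
  hg.continuousOn.comp
    (continuousOn_id.prodMk (hu.continuousOn.prodMk (continuousOn_grad hΩ hu))) fun _ hx => hx

theorem exists_jet_bound (hΩ : IsBoundedSmoothDomain Ω) (hu : IsC2 Ω u) :
    ∃ m : ℝ, ∀ x ∈ closure Ω, ‖u x‖ ≤ m ∧ ‖grad Ω u x‖ ≤ m := by
  obtain ⟨m, hm⟩ := hΩ.isCompact_closure.exists_bound_of_continuousOn
    (hu.continuousOn.prodMk (continuousOn_grad hΩ hu))
  exact ⟨m, fun x hx => norm_prod_le_iff.1 (hm x hx)⟩

theorem exists_Rmat_bound (hΩ : IsBoundedSmoothDomain Ω) (hu : IsC2 Ω u)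
    {A B : E n × ℝ × E n → Matrix (Fin n) (Fin n) ℝ} (hA : ∀ i j, IsC1 Ω fun q => A q i j)
    (hB : ∀ i j, IsC1 Ω fun q => B q i j) :
    ∃ m : ℝ, ∀ x ∈ closure Ω, ∀ i j, |Rmat Ω A B u x i j| ≤ m := by
  have hcont : ContinuousOn (fun x => (fun i j => Rmat Ω A B u x i j : Fin n → Fin n → ℝ))
      (closure Ω) := continuousOn_pi.2 fun i => continuousOn_pi.2 fun j =>
    ((continuousOn_hess hΩ hu i j).sub (continuousOn_comp_jet hΩ hu (hA i j))).sub
      (continuousOn_comp_jet hΩ hu (hB i j))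
  obtain ⟨m, hm⟩ := hΩ.isCompact_closure.exists_bound_of_continuousOn hcont
  refine ⟨m, fun x hx i j => le_trans ?_ (hm x hx)⟩
  exact (norm_le_pi_norm ((fun i j => Rmat Ω A B u x i j : Fin n → Fin n → ℝ) i) j).trans
    (norm_le_pi_norm (fun i j => Rmat Ω A B u x i j : Fin n → Fin n → ℝ) i)

theorem omega_transpose (hΩ : IsBoundedSmoothDomain Ω) (hu : IsC2 Ω u)
    {A : E n × ℝ × E n → Matrix (Fin n) (Fin n) ℝ} (hA_symm : ∀ q ∈ dom Ω, (A q)ᵀ = A q)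
    {x : E n} (hx : x ∈ Ω) : (omega Ω A u x)ᵀ = omega Ω A u x := by
  rw [omega, transpose_sub, hess_transpose hΩ hu hx,
    hA_symm (x, u x, grad Ω u x) (subset_closure hx)]

theorem log_sub_log_le_of_Dz {f : E n × ℝ × E n → ℝ} (hf : IsC1 Ω f)
    (hf_pos : ∀ q ∈ dom Ω, 0 < f q) {κ : ℝ} (hDzf : ∀ q ∈ dom Ω, κ ≤ Dz f q / f q)
    {x : E n} (hx : x ∈ closure Ω) (p : E n) {z₁ z₂ : ℝ} (hz : z₁ ≤ z₂) :
    κ * (z₂ - z₁) ≤ Real.log (f (x, z₂, p)) - Real.log (f (x, z₁, p)) := by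
  have hd : ∀ t, HasDerivAt (fun t => Real.log (f (x, t, p)))
      (Dz f (x, t, p) / f (x, t, p)) t := fun t =>
    (hasDerivAt_Dz hf hx t p).1.log (hf_pos (x, t, p) hx).ne'
  exact mul_sub_le_image_sub_of_le_deriv (f := fun t => Real.log (f (x, t, p)))
    (fun t => (hd t).differentiableAt) (fun t => by rw [(hd t).deriv]; exact hDzf (x, t, p) hx) hz

/-- If `u < v` somewhere in `Ω` but `u ≥ v` on the boundary, the perturbed difference
`u - v - ε φ` has, for a suitable `ε > 0`, an interior minimum at which `u < v`. -/
theorem exists_interior_min {v φ : E n → ℝ} (hΩ : IsBoundedSmoothDomain Ω)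
    (hu : ContinuousOn u (closure Ω)) (hv : ContinuousOn v (closure Ω))
    (hφ : ContinuousOn φ (closure Ω)) (hφ_pos : ∀ x, 0 < φ x)
    (hbdry : ∀ x ∈ frontier Ω, v x ≤ u x) {x₁ : E n} (hx₁ : x₁ ∈ Ω) (hlt : u x₁ < v x₁) :
    ∃ ε > 0, ∃ x ∈ Ω, u x < v x ∧ ∀ y ∈ Ω, u x - v x - ε * φ x ≤ u y - v y - ε * φ y := by
  obtain ⟨C, hC⟩ := hΩ.isCompact_closure.exists_bound_of_continuousOn hφ
  have hC' : ∀ x ∈ closure Ω, φ x ≤ C := fun x hx => (le_abs_self _).trans (hC x hx)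
  have hC0 : 0 < C := (hφ_pos x₁).trans_le (hC' x₁ (subset_closure hx₁))
  -- With `φ ≤ C`, comparing the minimum with `x₁` gives `u - v < -ε C + ε φ ≤ 0` there; the
  -- boundary is then excluded.
  set ε := (v x₁ - u x₁) / C with hε
  have hε0 : 0 < ε := div_pos (sub_pos.2 hlt) hC0
  have hεC : ε * C = v x₁ - u x₁ := div_mul_cancel₀ _ hC0.ne'
  obtain ⟨x, hx, hmin⟩ := hΩ.isCompact_closure.exists_isMinOn ⟨x₁, subset_closure hx₁⟩
    ((hu.sub hv).sub (hφ.const_smul ε))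
  have hmin' : ∀ y ∈ closure Ω, u x - v x - ε * φ x ≤ u y - v y - ε * φ y := hmin
  have h1 := hmin' x₁ (subset_closure hx₁)
  have h2 := mul_pos hε0 (hφ_pos x₁)
  have h3 := mul_le_mul_of_nonneg_left (hC' x hx) hε0.le
  have hneg : u x < v x := by linarith
  have hxΩ : x ∈ Ω := by
    by_contra hxΩ
    have := hbdry x (by rw [frontier, hΩ.isOpen.interior_eq]; exact ⟨hx, hxΩ⟩)
    linarith
  exact ⟨ε, hε0, x, hxΩ, hneg, fun y hy => hmin' y (subset_closure hy)⟩

end Bounds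

/-- At an interior minimum of `u - v - ε exp (γ (x₁ + ⋯ + xₙ))` where `u < v`, the operator `G_k`
increases up to terms of the order of the gradient of the perturbation. -/
theorem Gk_sub_ge_at_interior_min {n k : ℕ} (hk0 : 0 < k) (hkn : k ≤ n) {Ω : Set (E n)}
    (hΩ : IsBoundedSmoothDomain Ω) {A B : E n × ℝ × E n → Matrix (Fin n) (Fin n) ℝ}
    {f : E n × ℝ × E n → ℝ} (hA : ∀ i j, IsC1 Ω fun q => A q i j)
    (hA_symm : ∀ q ∈ dom Ω, (A q)ᵀ = A q) (hB : ∀ i j, IsC1 Ω fun q => B q i j)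
    (hB_skew : ∀ q ∈ dom Ω, (B q)ᵀ = -B q) (hf : IsC1 Ω f) {δ β₁ c m L L' : ℝ}
    (hδ₀ : 0 < δ) (hδ₁ : δ < 1) (hβ₁ : 0 < β₁) (hc : 0 < c) (hm : 0 < m) {u v : E n → ℝ}
    (hu : IsC2 Ω u) (hv : IsC2 Ω v) (hDzA : ∀ q ∈ dom Ω, (DzMat A q).PosSemidef)
    (hopB : ∀ q ∈ dom Ω, opNorm (B q) ≤ δ * c)
    (hopDzB : ∀ q ∈ dom Ω, opNorm (DzMat B q) ≤ β₁ * c) (hf_pos : ∀ q ∈ dom Ω, 0 < f q)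
    (hDzf : ∀ q ∈ dom Ω, (k : ℝ) * δ / (1 + δ ^ 2) * β₁ ≤ Dz f q / f q)
    {x : E n} (hx : x ∈ Ω) (hcu : c ≤ lambdaMin (omega Ω A u x))
    (hcv : c ≤ lambdaMin (omega Ω A v x)) (hmu : ∀ i j, |Rmat Ω A B u x i j| ≤ m)
    (hmv : ∀ i j, |Rmat Ω A B v x i j| ≤ m)
    (hL : ∀ i j, |A (x, v x, grad Ω u x) i j - A (x, v x, grad Ω v x) i j| +
      |B (x, v x, grad Ω u x) i j - B (x, v x, grad Ω v x) i j| ≤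
        L * ‖grad Ω u x - grad Ω v x‖)
    (hL' : |Real.log (f (x, v x, grad Ω u x)) - Real.log (f (x, v x, grad Ω v x))| ≤
      L' * ‖grad Ω u x - grad Ω v x‖)
    {ε γ : ℝ} (hε : 0 < ε) (hγ : 0 < γ) (huv : u x < v x)
    (hmin : ∀ y ∈ Ω, u x - v x - ε * Real.exp (γ * inner ℝ (onesVec n) x) ≤
      u y - v y - ε * Real.exp (γ * inner ℝ (onesVec n) y)) :
    ε * γ * Real.exp (γ * inner ℝ (onesVec n) x) *
        (γ * (c / (k * m ^ 2)) - (k ^ 2 * L / c + L') * ‖onesVec n‖) ≤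
      Gk k Ω A B f u x - Gk k Ω A B f v x := by
  have hxc : x ∈ closure Ω := subset_closure hx
  obtain ⟨hgrad, hP⟩ := interior_min_conditions hΩ hu hv hx hmin
  set a := ε * γ * Real.exp (γ * inner ℝ (onesVec n) x) with ha
  have ha0 : 0 < a := by positivity
  have hs : ε * γ ^ 2 * Real.exp (γ * inner ℝ (onesVec n) x) = a * γ := by rw [ha]; ring
  rw [hs] at hP
  have hnorm : ‖grad Ω u x - grad Ω v x‖ = a * ‖onesVec n‖ := by
    rw [hgrad, norm_smul, Real.norm_of_nonneg ha0.le]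
  rw [hnorm] at hL hL'
  set p := grad Ω u x with hp
  set q := grad Ω v x with hq
  have hQ := sub_posSemidef_of_Dz_posSemidef hA hA_symm hDzA hxc p huv.le
  have hΓ := bilinBound_sub_of_opNorm_Dz_le hB hopDzB hxc p huv.le
  have hlogf := log_sub_log_le_of_Dz hf hf_pos hDzf hxc p huv.le
  have hN : ∀ i j, |(-(A (x, v x, p) - A (x, v x, q)) - (B (x, v x, p) - B (x, v x, q))) i j| ≤
      L * (a * ‖onesVec n‖) := fun i j => by
    refine le_trans ?_ (hL i j)
    simp only [Matrix.sub_apply, Matrix.neg_apply]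
    refine (abs_sub _ _).trans (le_of_eq ?_)
    rw [abs_neg]
  have hWu := omega_transpose hΩ hu hA_symm hx
  have hWv := omega_transpose hΩ hv hA_symm hx
  -- The increment of the coefficients is split at `(x, v x, p)`: `z` changes at the gradient `p` of
  -- `u`, then the gradient changes at the value `v x`.
  have main := le_log_Sk_sub_log_Sk hk0 hkn (W₁ := omega Ω A v x) (W₂ := omega Ω A u x)
    (b₁ := B (x, v x, q)) (b₂ := B (x, u x, p)) (s := a * γ) hc hδ₀ hδ₁ hm (by positivity)
    (mul_pos (mul_pos hβ₁ hc) (sub_pos.2 huv)) hWv hWu (coercive_of_le_lambdaMin hWv hcv)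
    (coercive_of_le_lambdaMin hWu hcu) (hB_skew (x, v x, q) hxc) (hB_skew (x, u x, p) hxc)
    (bilinBound_of_opNorm_le (hopB (x, v x, q) hxc))
    (bilinBound_of_opNorm_le (hopB (x, u x, p) hxc)) hmv hmu (hP.add hQ)
    (by rw [transpose_sub, hB_skew (x, u x, p) hxc, hB_skew (x, v x, p) hxc]; abel) hΓ hN
    (by simp only [omega, ← hp, ← hq]; abel)
  -- The factor `c` from the bound on `D_z B` cancels the `c⁻¹` of the inverse, leaving exactly the
  -- amount supplied by `hlogf`.
  have hcancel : (k : ℝ) * (δ / ((1 + δ ^ 2) * c) * (β₁ * c * (v x - u x))) =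
      (k : ℝ) * δ / (1 + δ ^ 2) * β₁ * (v x - u x) := by
    field_simp
  rw [hcancel] at main
  have hlog' := (abs_le.1 hL').2
  have hexpand : a * (γ * (c / (k * m ^ 2)) - (k ^ 2 * L / c + L') * ‖onesVec n‖) =
      a * γ * (c / (k * m ^ 2)) - k ^ 2 * (L * (a * ‖onesVec n‖)) / c -
        L' * (a * ‖onesVec n‖) := by ring
  rw [hexpand]
  simp only [Gk, Rmat, ← hp, ← hq]
  linarith

end NonsymHessian

/-! ### Choice of constants and conclusion. -/

open NonsymHessian in
theorem theorem2p2 (n k : ℕ) (hk : 2 ≤ k) (hkn : k ≤ n)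
    (Ω : Set (NonsymHessian.E n)) (hΩ : NonsymHessian.IsBoundedSmoothDomain Ω)
    (A B : NonsymHessian.E n × ℝ × NonsymHessian.E n → Matrix (Fin n) (Fin n) ℝ)
    (f : NonsymHessian.E n × ℝ × NonsymHessian.E n → ℝ)
    (hA : ∀ i j, NonsymHessian.IsC1 Ω (fun q => A q i j))
    (hA_symm : ∀ q ∈ NonsymHessian.dom Ω, (A q).transpose = A q)
    (hB : ∀ i j, NonsymHessian.IsBC1 Ω (fun q => B q i j))
    (hB_skew : ∀ q ∈ NonsymHessian.dom Ω, (B q).transpose = -B q)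
    (hf : NonsymHessian.IsC1 Ω f)
    (δ β₁ : ℝ) (hδ₀ : 0 < δ) (hδ₁ : δ < 1) (hβ₁ : 0 < β₁)
    (u v : NonsymHessian.E n → ℝ)
    (hu : NonsymHessian.IsC2 Ω u) (hv : NonsymHessian.IsC2 Ω v)
    (hG : ∀ x ∈ Ω, NonsymHessian.Gk k Ω A B f u x ≤ NonsymHessian.Gk k Ω A B f v x)
    (hlu : 0 < NonsymHessian.lambdaInf Ω A u) (hlv : 0 < NonsymHessian.lambdaInf Ω A v)
    (hDzA : ∀ q ∈ NonsymHessian.dom Ω, (NonsymHessian.DzMat A q).PosSemidef)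
    (hmuB : NonsymHessian.mu Ω B
      ≤ δ * min (NonsymHessian.lambdaInf Ω A u) (NonsymHessian.lambdaInf Ω A v))
    (hmuDzB : NonsymHessian.mu Ω (NonsymHessian.DzMat B)
      ≤ β₁ * min (NonsymHessian.lambdaInf Ω A u) (NonsymHessian.lambdaInf Ω A v))
    (hf_pos : ∀ q ∈ NonsymHessian.dom Ω, 0 < f q)
    (hDzf : ∀ q ∈ NonsymHessian.dom Ω,
      (k : ℝ) * δ / (1 + δ ^ 2) * β₁ ≤ NonsymHessian.Dz f q / f q) :
    ((∀ x ∈ frontier Ω, v x ≤ u x) → ∀ x ∈ Ω, v x ≤ u x) ∧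
    ((∀ x ∈ frontier Ω, u x = v x) →
      ∀ x ∈ frontier Ω, ∀ ν, NonsymHessian.IsInwardUnitNormal Ω x ν →
        NonsymHessian.normalDeriv Ω v x ν ≤ NonsymHessian.normalDeriv Ω u x ν) := by
  have hB' : ∀ i j, IsC1 Ω fun q => B q i j := fun i j => (hB i j).1
  set c := min (lambdaInf Ω A u) (lambdaInf Ω A v) with hc
  have hc0 : 0 < c := lt_min hlu hlv
  have hopB : ∀ q ∈ dom Ω, opNorm (B q) ≤ δ * c := fun q hq =>
    (opNorm_le_mu (fun i j => (hB i j).2.imp fun C hC q hq => (hC q hq).1) hq).trans hmuB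
  have hopDzB : ∀ q ∈ dom Ω, opNorm (DzMat B q) ≤ β₁ * c := fun q hq =>
    (opNorm_le_mu (fun i j => (hB i j).2.imp fun C hC q hq =>
      (abs_Dz_le (hB' i j) hq).trans (hC q hq).2) hq).trans hmuDzB
  have comparison : (∀ x ∈ frontier Ω, v x ≤ u x) → ∀ x ∈ Ω, v x ≤ u x := by
    intro hbdry x₁ hx₁
    by_contra! hlt
    obtain ⟨mu₀, hmu⟩ := exists_jet_bound hΩ hu
    obtain ⟨mv₀, hmv⟩ := exists_jet_bound hΩ hv
    obtain ⟨Mu, hMu⟩ := exists_Rmat_bound hΩ hu hA hB'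
    obtain ⟨Mv, hMv⟩ := exists_Rmat_bound hΩ hv hA hB'
    obtain ⟨LA, hLA0, hLA⟩ := exists_lipschitz_gradient_variable_matrix hΩ hA (max mu₀ mv₀)
    obtain ⟨LB, hLB0, hLB⟩ := exists_lipschitz_gradient_variable_matrix hΩ hB' (max mu₀ mv₀)
    obtain ⟨Lf, hLf0, hLf⟩ := exists_lipschitz_gradient_variable hΩ
      (hf.log fun q hq => (hf_pos q hq).ne') (max mu₀ mv₀)
    set m := max (max Mu Mv) 1 with hm
    have hm0 : 0 < m := lt_max_of_lt_right one_pos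
    have hk0 : (0 : ℝ) < k := by exact_mod_cast (by omega : 0 < k)
    set D := ((k : ℝ) ^ 2 * (LA + LB) / c + Lf) * ‖onesVec n‖ with hD
    have hD0 : 0 ≤ D := by positivity
    -- Chosen so that the gain `γ c / (k m²)` exceeds the gradient error `D` by exactly one. `D` and
    -- `m` are independent of `γ` and `ε`, so there is no circularity.
    set γ := (D + 1) * (k * m ^ 2) / c with hγ
    have hγ0 : 0 < γ := by positivity
    obtain ⟨ε, hε, x, hx, huv, hmin⟩ := exists_interior_min
      (φ := fun x => Real.exp (γ * inner ℝ (onesVec n) x)) hΩ hu.continuousOn hv.continuousOn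
      (by fun_prop) (fun _ => Real.exp_pos _) hbdry hx₁ hlt
    have hxc : x ∈ closure Ω := subset_closure hx
    have hvx : ‖v x‖ ≤ max mu₀ mv₀ := (hmv x hxc).1.trans (le_max_right _ _)
    have hpu : ‖grad Ω u x‖ ≤ max mu₀ mv₀ := (hmu x hxc).2.trans (le_max_left _ _)
    have hpv : ‖grad Ω v x‖ ≤ max mu₀ mv₀ := (hmv x hxc).2.trans (le_max_right _ _)
    have key := Gk_sub_ge_at_interior_min (k := k) (by omega) hkn hΩ hA hA_symm hB' hB_skew hf hδ₀
      hδ₁ hβ₁ hc0 hm0 hu hv hDzA hopB hopDzB hf_pos hDzf hx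
      ((min_le_left _ _).trans (lambdaInf_le hlu hxc))
      ((min_le_right _ _).trans (lambdaInf_le hlv hxc))
      (fun i j => (hMu x hxc i j).trans ((le_max_left _ _).trans (le_max_left _ _)))
      (fun i j => (hMv x hxc i j).trans ((le_max_right _ _).trans (le_max_left _ _)))
      (L := LA + LB) (L' := Lf)
      (fun i j => by
        have h1 := hLA x hxc _ hvx _ _ hpu hpv i j
        have h2 := hLB x hxc _ hvx _ _ hpu hpv i j
        linarith)
      (hLf x hxc _ hvx _ _ hpu hpv) hε hγ0 huv hmin
    have hval : γ * (c / (k * m ^ 2)) = D + 1 := by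
      rw [hγ]
      field_simp
    rw [hval, ← hD, add_sub_cancel_left, mul_one] at key
    have hpos : 0 < ε * γ * Real.exp (γ * inner ℝ (onesVec n) x) := by positivity
    have := hG x hx
    linarith
  refine ⟨comparison, fun heq x hx ν hν => ?_⟩
  exact normalDeriv_le_of_le hu hv (comparison fun y hy => (heq y hy).ge) hx (heq x hx) hν
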